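/- For $b>1$ and $a\in[0,2-b]$ put $p=(1-a)/b$ and let $T^{+}_{b,a}(x)=bx+a$ if $x<p$, $T^{+}_{b,a}(x)=bx+a-1$ if $x\ge p$; let $T^{-}_{b,a}(x)=bx+a$ if $x\le p$, $T^{-}_{b,a}(x)=bx+a-1$ if $x>p$. Let $\operatorname{Preper}^{\pm}(b,a)$ be the set of $x\in[-a/(b-1),(1-a)/(b-1)]$ with finite orbit under $T^{\pm}_{b,a}$. Let $\nu_{b,a}$ be the Parry measure, that is, the probability measure proportional to the measure with Lebesgue density $$h_{b,a}=\sum_{j\ge 0}b^{-j}\bigl(\mathbf 1_{[0,(T^{+}_{b,a})^{j}(1))}-\mathbf 1_{[0,(T^{+}_{b,a})^{j}(0))}\bigr).$$ A map $T$ of $[0,1]$ is called topologically transitive if for every non-empty open interval $U\subseteq[0,1]$ there is an $m$ with $(0,1)\subseteq\bigcup_{j=0}^{m}T^{j}(U)$. Let $1\le k<n$ be coprime integers. Write $n=mk+s$ with $0\le s<k$. If $k\ge2$ (so $s\ge1$), put $V_0=0$, $V_j=\lfloor jk/s\rfloor$, $h_j=V_j-V_{j-1}$ and $$W_j=W_j(b)=\sum_{i=1}^{h_j}b^{(V_s-V_{j-1}-i)m+s-j}\quad(1\le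 j\le s),\qquad W=W(b)=\sum_{j=1}^{s}W_j;$$ if $k=1$, put $W=1$. With $S=b^{n-1}+\dots+b+1$ let $$I_{n,k}(b)=\Bigl[\tfrac{1+b(W-1)}{bS},\ \tfrac{bW-b^{n+1}+b^{n}+b-1}{bS}\Bigr].$$ Let $\beta$ be a Pisot number (a real algebraic integer $>1$ whose other Galois conjugates all have modulus $<1$), let $\alpha\in\mathbb Q(\beta)\cap[0,2-\beta]$, and assume that $\beta>\sqrt2$ or that one of $T^{+}_{\beta,\alpha}$, $T^{-}_{\beta,\alpha}$ is topologically transitive on $[0,1]$. Put $b=\beta^{1/n}$, $$a=\alpha_{n,k}=\frac{\bigl((1-\alpha)(1-b^{-1})-W(b)\bigr)(1-b)}{\beta-1},\qquad \Phi(x)=(b-1)x+a.$$ Then $a\in I_{n,k}(b)$, and $$\operatorname{Preper}^{+}(b,a)\cap\operatorname{supp}\nu_{b,a}=\{1\}\cup\bigcup_{i=0}^{n-1}(T^{+}_{b,a})^{i}\bigl(\Phi(\mathbb Q(\beta)\cap[0,1])\bigr),$$ $$\operatorname{Preper}^{-}(b,a)\cap\operatorname{supp}\nu_{b,a}=\{0\}\cup\bigcup_{i=0}^{n-1}(T^{-}_{b,a})^{i}\bigl(\Phi(\mathbb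 Q(\beta)\cap[0,1])\bigr).$$ -/

import Mathlib

open MeasureTheory

noncomputable section

/-- A Pisot number: a real algebraic integer `β > 1` all of whose other Galois conjugates lie in
the open unit disc. -/
def IsPisot (β : ℝ) : Prop :=
  1 < β ∧ IsIntegral ℤ β ∧
    ∀ z : ℂ, z ∈ (minpoly ℚ β).aroots ℂ → z ≠ (β : ℂ) → ‖z‖ < 1

/-- The intermediate `β`-transformation `T⁺`, with discontinuity `p = (1 - α) / β`. -/
def Tplus (β α x : ℝ) : ℝ :=
  if x < (1 - α) / β then β * x + α else β * x + α - 1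

/-- The intermediate `β`-transformation `T⁻`. -/
def Tminus (β α x : ℝ) : ℝ :=
  if x ≤ (1 - α) / β then β * x + α else β * x + α - 1

/-- The domain `J` of the maps `T⁺` and `T⁻`. -/
def betaDomain (β α : ℝ) : Set ℝ :=
  Set.Icc (-α / (β - 1)) ((1 - α) / (β - 1))

/-- The points of `J` whose orbit under `T⁺` is finite. -/
def PreperPlus (β α : ℝ) : Set ℝ :=
  {x | x ∈ betaDomain β α ∧ (Set.range fun j : ℕ => (Tplus β α)^[j] x).Finite}

/-- The points of `J` whose orbit under `T⁻` is finite. -/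
def PreperMinus (β α : ℝ) : Set ℝ :=
  {x | x ∈ betaDomain β α ∧ (Set.range fun j : ℕ => (Tminus β α)^[j] x).Finite}

/-- Topological transitivity of `T` on `[0, 1]`: finitely many iterates of any nonempty open
subinterval cover `(0, 1)`. -/
def IsTransitiveOnUnit (T : ℝ → ℝ) : Prop :=
  ∀ c d : ℝ, 0 ≤ c → c < d → d ≤ 1 →
    ∃ m : ℕ, Set.Ioo (0 : ℝ) 1 ⊆ ⋃ j ∈ Set.Iic m, T^[j] '' Set.Ioo c d

/-- Parry's (unnormalised) invariant density. -/
def parryDensity (β α x : ℝ) : ℝ :=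
  ∑' j : ℕ, (β ^ j)⁻¹ *
    ((Set.Ico 0 ((Tplus β α)^[j] 1)).indicator (fun _ => (1 : ℝ)) x -
      (Set.Ico 0 ((Tplus β α)^[j] 0)).indicator (fun _ => (1 : ℝ)) x)

/-- The measure with density `parryDensity` with respect to Lebesgue measure. -/
def parryMeasureAux (β α : ℝ) : Measure ℝ :=
  volume.withDensity fun x => ENNReal.ofReal (parryDensity β α x)

/-- The Parry measure, normalised to total mass one. -/
def parryMeasure (β α : ℝ) : Measure ℝ :=
  (parryMeasureAux β α Set.univ)⁻¹ • parryMeasureAux β α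

/-- With `n = m k + s`, `0 ≤ s < k`, the integer `V_j` is the quotient of `j k` by `s`
(and `V_0 = 0`). -/
def lorenzV (n k j : ℕ) : ℕ := j * k / (n % k)

/-- `W_j = ∑_{i=1}^{h_j} b ^ ((V_s - V_{j-1} - i) m + s - j)`, where `n = m k + s` and
`h_j = V_j - V_{j-1}`.  For `1 ≤ j ≤ s` and `1 ≤ i ≤ h_j` all the subtractions are exact. -/
def lorenzW (n k : ℕ) (b : ℝ) (j : ℕ) : ℝ :=
  ∑ i ∈ Finset.Icc 1 (lorenzV n k j - lorenzV n k (j - 1)),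
    b ^ ((lorenzV n k (n % k) - lorenzV n k (j - 1) - i) * (n / k) + n % k - j)

/-- `∑_{j=1}^{s} W_j` for `2 ≤ k`. -/
def lorenzSum (n k : ℕ) (b : ℝ) : ℝ :=
  ∑ j ∈ Finset.Icc 1 (n % k), lorenzW n k b j

/-- The parameter interval `I_{n,k}(b)`. -/
def parameterInterval (n k : ℕ) (b : ℝ) : Set ℝ :=
  if k = 1 then
    Set.Icc (1 / (b * ∑ i ∈ Finset.range n, b ^ i))
      ((-b ^ (n + 1) + b ^ n + 2 * b - 1) / (b * ∑ i ∈ Finset.range n, b ^ i))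
  else
    Set.Icc ((1 + b * (lorenzSum n k b - 1)) / (b * ∑ i ∈ Finset.range n, b ^ i))
      ((b * lorenzSum n k b - b ^ (n + 1) + b ^ n + b - 1) /
        (b * ∑ i ∈ Finset.range n, b ^ i))

/-- The positive `n`-th root of `β`. -/
def nthRoot (n : ℕ) (β : ℝ) : ℝ := β ^ ((1 : ℝ) / n)

/-- The renormalised parameter `α_{n,k}(β, α)`. -/
def renormParam (n k : ℕ) (β α : ℝ) : ℝ :=
  if k = 1 then
    (((1 - α) * (1 - nthRoot n β⁻¹) - 1) * (1 - nthRoot n β)) / (β - 1)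
  else
    (((1 - α) * (1 - nthRoot n β⁻¹) - lorenzSum n k (nthRoot n β)) * (1 - nthRoot n β)) /
      (β - 1)

/-- The affine map `Φ(x) = (β^{1/n} - 1) x + α_{n,k}`. -/
def renormPhi (n k : ℕ) (β α x : ℝ) : ℝ :=
  (nthRoot n β - 1) * x + renormParam n k β α

/-- The field `ℚ(β)` as a set of real numbers. -/
def fieldQ (β : ℝ) : Set ℝ := (IntermediateField.adjoin ℚ ({β} : Set ℝ) : Set ℝ)

end

open MeasureTheory Filter Topology Set

noncomputable section

/-! Write `T` for the map with parameters `b, a` and `T_β` for the one with parameters `β, α`. The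
point is that `T` is an `n`-step renormalisation of `T_β` along the rotation by `k/n`. With `S = 1 +
b + ... + b^(n-1)`, cut the circle into `n` tiles in cyclic order, the tile numbered `(i+1)k` mod
`n` having length `b^i / S`. Level `i` of a tower is an interval of length `b^i (b-1)` inside that
tile (`towerMap`), and level `0` is `Φ([0,1])`. The map `T` carries each level affinely onto the
next. Its discontinuity meets only level `n-2`, at the parameter where `T_β` is discontinuous. Level
`n-1` is therefore cut there and wraps around `0 ≡ 1`, and the next step returns to level `0`. This
gives `T^n ∘ Φ = Φ ∘ T_β` on `[0,1]` (`iterate_return`), so `Φ(x)` has a finite orbit exactly when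
`x` has one under `T_β`.

For `β` Pisot and `α` in `ℚ(β)`, the points of `[0,1]` with finite `T_β`-orbit are those of `ℚ(β)`:
two equal iterates give a linear equation over `ℚ(β)` (`mem_fieldQ_of_finite_orbit`), and conversely
an orbit in `ℚ(β)` has bounded denominators and bounded conjugates (`finite_orbit_of_mem_fieldQ`).

It remains to see that the support is the closed tower (`support_parryMeasure`). Off the tower the
orbits of `0` and `1` pass through the levels on the same side of `x`, so the terms of the density
cancel, except those at level `n-1`, which add up to `-1` against the initial term `1`
(`parryDensity_eq_zero_off_tower`). On the tower, the density is fixed by the transfer operator, so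
its positivity set is forward invariant. Its left limit at the discontinuity is `b > 0`; carried
into level `0`, this yields a `T_β`-invariant set containing an interval, which fills `(0,1)` up to
a countable set by expansion or by transitivity.

The separate points `1` and `0` in the two formulas arise at the cut: the closed tower contains
both, while each of the two maps takes only one of them as its value there. -/

/-- The digit of `x`: the index of the branch of `Tplus β α` at `x`. -/
def betaDigit (β α x : ℝ) : ℝ := if x < (1 - α) / β then 0 else 1

lemma Tplus_eq_sub_betaDigit (β α x : ℝ) : Tplus β α x = β * x + α - betaDigit β α x := by
  unfold Tplus betaDigit; split_ifs <;> ring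

lemma betaDigit_eq_indicator (β α x : ℝ) :
    betaDigit β α x = (Iic x).indicator (fun _ => (1 : ℝ)) ((1 - α) / β) := by
  unfold betaDigit
  by_cases h : x < (1 - α) / β
  · simp [h]
  · simp [h, not_lt.1 h]

lemma abs_betaDigit_sub_le (β α x y : ℝ) : |betaDigit β α x - betaDigit β α y| ≤ 1 := by
  unfold betaDigit; split_ifs <;> norm_num

/-! ### Parry's density as a fixed point of the transfer operator. -/

section
variable {β α : ℝ}

lemma Tplus_mem_Icc (hβ : 1 < β) (hα : α ∈ Icc 0 (2 - β)) {x : ℝ} (hx : x ∈ Icc (0 : ℝ) 1) :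
    Tplus β α x ∈ Icc (0 : ℝ) 1 := by
  obtain ⟨h0, h2⟩ := hα
  obtain ⟨x0, x1⟩ := hx
  have hβ0 : 0 < β := by linarith
  unfold Tplus
  split_ifs with h
  · rw [lt_div_iff₀ hβ0] at h
    constructor <;> nlinarith
  · rw [not_lt, div_le_iff₀ hβ0] at h
    constructor <;> nlinarith

lemma Tminus_mem_Icc (hβ : 1 < β) (hα : α ∈ Icc 0 (2 - β)) {x : ℝ} (hx : x ∈ Icc (0 : ℝ) 1) :
    Tminus β α x ∈ Icc (0 : ℝ) 1 := by
  obtain ⟨h0, h2⟩ := hα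
  obtain ⟨x0, x1⟩ := hx
  have hβ0 : 0 < β := by linarith
  unfold Tminus
  split_ifs with h
  · rw [le_div_iff₀ hβ0] at h
    constructor <;> nlinarith
  · rw [not_le, div_lt_iff₀ hβ0] at h
    constructor <;> nlinarith

lemma iterate_mem_Icc {T : ℝ → ℝ} (hT : ∀ x ∈ Icc (0 : ℝ) 1, T x ∈ Icc (0 : ℝ) 1) {x : ℝ}
    (hx : x ∈ Icc (0 : ℝ) 1) (j : ℕ) : T^[j] x ∈ Icc (0 : ℝ) 1 := by
  induction j with
  | zero => exact hx
  | succ j ih => rw [Function.iterate_succ_apply']; exact hT _ ih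

lemma Tplus_iterate_mem_Icc (hβ : 1 < β) (hα : α ∈ Icc 0 (2 - β)) {x : ℝ}
    (hx : x ∈ Icc (0 : ℝ) 1) (j : ℕ) : (Tplus β α)^[j] x ∈ Icc (0 : ℝ) 1 :=
  iterate_mem_Icc (fun _ => Tplus_mem_Icc hβ hα) hx j

lemma summable_inv_pow (hβ : 1 < β) : Summable fun j : ℕ => (β ^ j)⁻¹ := by
  simp_rw [← inv_pow]
  exact summable_geometric_of_lt_one (by positivity) (inv_lt_one_of_one_lt₀ hβ)

/-- The digit expansions of `1` and `0`, subtracted. -/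
lemma hasSum_betaDigit_sub (hβ : 1 < β) (hα : α ∈ Icc 0 (2 - β)) :
    HasSum (fun j : ℕ => (β ^ (j + 1))⁻¹ * (betaDigit β α ((Tplus β α)^[j] 1) -
      betaDigit β α ((Tplus β α)^[j] 0))) 1 := by
  have hβ0 : 0 < β := by linarith
  have hs : Summable fun j : ℕ => (β ^ (j + 1))⁻¹ :=
    (summable_nat_add_iff (f := fun j : ℕ => (β ^ j)⁻¹) 1).2 (summable_inv_pow hβ)
  have hsum : Summable (fun j : ℕ => (β ^ (j + 1))⁻¹ * (betaDigit β α ((Tplus β α)^[j] 1) -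
      betaDigit β α ((Tplus β α)^[j] 0))) := by
    refine Summable.of_norm_bounded hs fun j => ?_
    rw [norm_mul, Real.norm_eq_abs, Real.norm_eq_abs, abs_of_pos (by positivity)]
    exact mul_le_of_le_one_right (by positivity) (abs_betaDigit_sub_le _ _ _ _)
  rw [hsum.hasSum_iff_tendsto_nat]
  -- Telescoping: the digits cancel from `β` times the difference of the two orbits, and the initial
  -- difference is `1 - 0`.
  have hpart : ∀ N : ℕ, ∑ j ∈ Finset.range N, (β ^ (j + 1))⁻¹ *
      (betaDigit β α ((Tplus β α)^[j] 1) - betaDigit β α ((Tplus β α)^[j] 0)) =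
      1 - (β ^ N)⁻¹ * ((Tplus β α)^[N] 1 - (Tplus β α)^[N] 0) := by
    intro N
    induction N with
    | zero => simp
    | succ N ih =>
      rw [Finset.sum_range_succ, ih, Function.iterate_succ_apply', Function.iterate_succ_apply',
        Tplus_eq_sub_betaDigit β α ((Tplus β α)^[N] 1),
        Tplus_eq_sub_betaDigit β α ((Tplus β α)^[N] 0)]
      field_simp
      ring
  simp_rw [hpart]
  have h0 : Tendsto (fun N : ℕ => (β ^ N)⁻¹ * ((Tplus β α)^[N] 1 - (Tplus β α)^[N] 0))
      atTop (𝓝 0) := by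
    refine squeeze_zero_norm (fun N => ?_) (summable_inv_pow hβ).tendsto_atTop_zero
    rw [norm_mul, Real.norm_eq_abs, Real.norm_eq_abs, abs_of_pos (by positivity)]
    refine mul_le_of_le_one_right (by positivity) ?_
    have h1 := Tplus_iterate_mem_Icc hβ hα (x := 1) (by simp) N
    have h2 := Tplus_iterate_mem_Icc hβ hα (x := 0) (by simp) N
    rw [abs_le]
    constructor <;> linarith [h1.1, h1.2, h2.1, h2.2]
  simpa using tendsto_const_nhds.sub h0

/-- The `j`-th term of Parry's density. -/
def parryTerm (β α : ℝ) (j : ℕ) (x : ℝ) : ℝ :=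
  (β ^ j)⁻¹ * ((Ico 0 ((Tplus β α)^[j] 1)).indicator (fun _ => (1 : ℝ)) x -
      (Ico 0 ((Tplus β α)^[j] 0)).indicator (fun _ => (1 : ℝ)) x)

lemma parryDensity_eq_tsum (β α x : ℝ) : parryDensity β α x = ∑' j, parryTerm β α j x := rfl

lemma abs_indicator_sub_le (s t : Set ℝ) (x : ℝ) :
    |s.indicator (fun _ => (1 : ℝ)) x - t.indicator (fun _ => (1 : ℝ)) x| ≤ 1 := by
  unfold indicator; split_ifs <;> norm_num

lemma norm_parryTerm_le (hβ : 1 < β) (j : ℕ) (x : ℝ) : ‖parryTerm β α j x‖ ≤ (β ^ j)⁻¹ := by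
  have hβ0 : 0 < β := by linarith
  unfold parryTerm
  rw [norm_mul, Real.norm_eq_abs, Real.norm_eq_abs, abs_of_pos (by positivity)]
  exact mul_le_of_le_one_right (by positivity) (abs_indicator_sub_le _ _ _)

lemma summable_parryTerm (hβ : 1 < β) (x : ℝ) : Summable fun j => parryTerm β α j x :=
  Summable.of_norm_bounded (summable_inv_pow hβ) fun j => norm_parryTerm_le hβ j x

lemma parryDensity_le (hβ : 1 < β) (x : ℝ) : |parryDensity β α x| ≤ ∑' j : ℕ, (β ^ j)⁻¹ :=
  tsum_of_norm_bounded (summable_inv_pow hβ).hasSum fun j => norm_parryTerm_le hβ j x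

lemma parryDensity_eq_zero (hβ : 1 < β) (hα : α ∈ Icc 0 (2 - β)) {x : ℝ}
    (hx : x ∉ Ico (0 : ℝ) 1) : parryDensity β α x = 0 := by
  rw [parryDensity_eq_tsum]
  have : ∀ j, parryTerm β α j x = 0 := by
    intro j
    have h1 := Tplus_iterate_mem_Icc hβ hα (x := 1) (by simp) j
    have h2 := Tplus_iterate_mem_Icc hβ hα (x := 0) (by simp) j
    unfold parryTerm
    rw [indicator_of_notMem fun h => hx ⟨h.1, h.2.trans_le h1.2⟩,
      indicator_of_notMem fun h => hx ⟨h.1, h.2.trans_le h2.2⟩]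
    simp
  simp [this]

lemma measurable_parryDensity (hβ : 1 < β) : Measurable (parryDensity β α) := by
  refine measurable_of_tendsto_metrizable (f := fun N x => ∑ j ∈ Finset.range N, parryTerm β α j x)
    (fun N => Finset.measurable_sum _ fun j _ => ?_) ?_
  · exact ((measurable_const.indicator measurableSet_Ico).sub
      (measurable_const.indicator measurableSet_Ico)).const_mul _
  · rw [tendsto_pi_nhds]
    exact fun x => (summable_parryTerm hβ x).hasSum.tendsto_sum_nat

lemma tendsto_indicator_Ico_nhdsGE (c x : ℝ) :
    Tendsto ((Ico 0 c).indicator (fun _ => (1 : ℝ))) (𝓝[≥] x)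
      (𝓝 ((Ico 0 c).indicator (fun _ => (1 : ℝ)) x)) := by
  refine tendsto_const_nhds.congr' ?_
  by_cases hc : x < c
  · by_cases h0 : 0 ≤ x
    · filter_upwards [Ico_mem_nhdsGE hc] with y hy
      rw [indicator_of_mem (show x ∈ Ico 0 c from ⟨h0, hc⟩),
        indicator_of_mem (show y ∈ Ico 0 c from ⟨h0.trans hy.1, hy.2⟩)]
    · filter_upwards [Ico_mem_nhdsGE (not_le.1 h0)] with y hy
      rw [indicator_of_notMem fun h => h0 h.1, indicator_of_notMem fun h => not_le.2 hy.2 h.1]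
  · filter_upwards [self_mem_nhdsWithin] with y hy
    rw [indicator_of_notMem fun h => hc h.2, indicator_of_notMem fun h => hc (hy.trans_lt h.2)]

lemma tendsto_indicator_Ico_nhdsLT {c x : ℝ} (hx : 0 < x) :
    Tendsto ((Ico 0 c).indicator (fun _ => (1 : ℝ))) (𝓝[<] x)
      (𝓝 ((Iic c).indicator (fun _ => (1 : ℝ)) x)) := by
  refine tendsto_const_nhds.congr' ?_
  by_cases hc : x ≤ c
  · filter_upwards [Ico_mem_nhdsLT hx] with y hy
    rw [indicator_of_mem (show x ∈ Iic c from hc),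
      indicator_of_mem (show y ∈ Ico 0 c from ⟨hy.1, hy.2.trans_le hc⟩)]
  · filter_upwards [Ico_mem_nhdsLT (not_le.1 hc)] with y hy
    rw [indicator_of_notMem (show x ∉ Iic c from hc),
      indicator_of_notMem (show y ∉ Ico 0 c from fun h => not_lt.2 hy.1 h.2)]

lemma parryDensity_rightContinuous (hβ : 1 < β) (x : ℝ) :
    ContinuousWithinAt (parryDensity β α) (Ici x) x := by
  refine tendsto_tsum_of_dominated_convergence (summable_inv_pow hβ) (fun j => ?_)
    (Eventually.of_forall fun y j => norm_parryTerm_le hβ j y)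
  exact ((tendsto_indicator_Ico_nhdsGE _ x).sub (tendsto_indicator_Ico_nhdsGE _ x)).const_mul _

/-- The left limit of `1_[0,c)` at `p = (1 - α)/β` is `1` exactly when `p ≤ c`, which is the digit
of `c`; so the limit is `β` times the digit sum of `hasSum_betaDigit_sub`. It supplies an interval
of positive density without any transitivity. -/
lemma parryDensity_tendsto_left (hβ : 1 < β) (hα : α ∈ Icc 0 (2 - β)) :
    Tendsto (parryDensity β α) (𝓝[<] ((1 - α) / β)) (𝓝 β) := by
  have hβ0 : 0 < β := by linarith
  have hp : 0 < (1 - α) / β := div_pos (by linarith [hα.2]) hβ0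
  have key : Tendsto (parryDensity β α) (𝓝[<] ((1 - α) / β))
      (𝓝 (∑' j : ℕ, (β ^ j)⁻¹ * (betaDigit β α ((Tplus β α)^[j] 1) -
        betaDigit β α ((Tplus β α)^[j] 0)))) := by
    refine tendsto_tsum_of_dominated_convergence (summable_inv_pow hβ) (fun j => ?_)
      (Eventually.of_forall fun y j => norm_parryTerm_le hβ j y)
    simp_rw [betaDigit_eq_indicator]
    exact ((tendsto_indicator_Ico_nhdsLT hp).sub (tendsto_indicator_Ico_nhdsLT hp)).const_mul _
  have h := (hasSum_betaDigit_sub hβ hα).mul_left β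
  rw [mul_one] at h
  refine key.trans_eq (congrArg _ (Eq.trans (tsum_congr fun j => ?_) h.tsum_eq))
  rw [pow_succ]; field_simp

/-- One step of the transfer operator of `Tplus β α`, applied to an indicator. -/
lemma transfer_indicator (hβ : 1 < β) (hα : α ∈ Icc 0 (2 - β)) {c : ℝ} (hc : c ∈ Icc (0 : ℝ) 1)
    (x : ℝ) :
    (if x < 1 then (Ico 0 c).indicator (fun _ => (1 : ℝ)) ((x - α) / β) else 0) +
      (if 0 ≤ x then (Ico 0 c).indicator (fun _ => (1 : ℝ)) ((x + 1 - α) / β) else 0) =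
    (Ico 0 (Tplus β α c)).indicator (fun _ => (1 : ℝ)) x +
      betaDigit β α c * (Ico 0 1).indicator (fun _ => (1 : ℝ)) x -
      (Ico 0 α).indicator (fun _ => (1 : ℝ)) x := by
  obtain ⟨h0, h2⟩ := hα
  obtain ⟨c0, c1⟩ := hc
  have hβ0 : 0 < β := by linarith
  have e1 : (x - α) / β ∈ Ico 0 c ↔ α ≤ x ∧ x < β * c + α := by
    rw [mem_Ico, le_div_iff₀ hβ0, div_lt_iff₀ hβ0]
    constructor <;> rintro ⟨h, h'⟩ <;> constructor <;> linarith
  have e2 : (x + 1 - α) / β ∈ Ico 0 c ↔ α - 1 ≤ x ∧ x < β * c + α - 1 := by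
    rw [mem_Ico, le_div_iff₀ hβ0, div_lt_iff₀ hβ0]
    constructor <;> rintro ⟨h, h'⟩ <;> constructor <;> linarith
  have hbc : β * c ≤ β := by nlinarith
  have hbc0 : 0 ≤ β * c := by positivity
  have e3 : c < (1 - α) / β ↔ β * c + α < 1 := by
    rw [lt_div_iff₀ hβ0]; constructor <;> intro h <;> linarith
  unfold Tplus betaDigit
  simp only [indicator, e1, e2, e3, mem_Ico]
  generalize β * c = u at *
  by_cases hc1 : u + α < 1 <;> simp only [hc1, if_true, if_false] <;>
  by_cases hx0 : 0 ≤ x <;> simp only [hx0, true_and, false_and, if_true, if_false] <;>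
  by_cases hx1 : x < 1 <;> simp only [hx1, if_true, if_false] <;>
  by_cases hxα : α ≤ x <;> by_cases hxu : x < u + α <;> by_cases hxu' : x < u + α - 1 <;>
  by_cases hxα' : α - 1 ≤ x <;>
  first
  | (exfalso; linarith)
  | simp [hxα, hxu, hxu', hxα', not_le.1]
  all_goals grind

/-- The transfer operator turns the `j`-th term into the next one plus a digit difference times
`1_[0,1)`. These digit differences sum to `1`, which restores the missing initial term `1_[0,1)`. -/
lemma parryDensity_transfer (hβ : 1 < β) (hα : α ∈ Icc 0 (2 - β)) (x : ℝ) :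
    β * parryDensity β α x = (if x < 1 then parryDensity β α ((x - α) / β) else 0) +
      (if 0 ≤ x then parryDensity β α ((x + 1 - α) / β) else 0) := by
  have hβ0 : 0 < β := by linarith
  have hL : HasSum (fun j => (if x < 1 then parryTerm β α j ((x - α) / β) else 0) +
      (if 0 ≤ x then parryTerm β α j ((x + 1 - α) / β) else 0))
      ((if x < 1 then parryDensity β α ((x - α) / β) else 0) +
      (if 0 ≤ x then parryDensity β α ((x + 1 - α) / β) else 0)) := by
    refine HasSum.add ?_ ?_
    · split_ifs
      exacts [(summable_parryTerm hβ _).hasSum, hasSum_zero]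
    · split_ifs
      exacts [(summable_parryTerm hβ _).hasSum, hasSum_zero]
  have hterm : ∀ j, (if x < 1 then parryTerm β α j ((x - α) / β) else 0) +
      (if 0 ≤ x then parryTerm β α j ((x + 1 - α) / β) else 0) =
      β * parryTerm β α (j + 1) x + β * ((β ^ (j + 1))⁻¹ * (betaDigit β α ((Tplus β α)^[j] 1) -
      betaDigit β α ((Tplus β α)^[j] 0))) * (Ico 0 1).indicator (fun _ => (1 : ℝ)) x := by
    intro j
    -- The summand `1_[0,α)` is the same for both orbits and drops out of the difference.
    have t1 := transfer_indicator hβ hα (Tplus_iterate_mem_Icc hβ hα (x := 1) (by simp) j) x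
    have t2 := transfer_indicator hβ hα (Tplus_iterate_mem_Icc hβ hα (x := 0) (by simp) j) x
    unfold parryTerm
    rw [Function.iterate_succ_apply', Function.iterate_succ_apply']
    have hpow : β * (β ^ (j + 1))⁻¹ = (β ^ j)⁻¹ := by rw [pow_succ]; field_simp
    have e : ∀ A B C : ℝ, β * ((β ^ (j + 1))⁻¹ * A) + β * ((β ^ (j + 1))⁻¹ * B) * C =
        (β ^ j)⁻¹ * (A + B * C) := by intro A B C; rw [← hpow]; ring
    rw [e]
    have e' : ∀ A B C D : ℝ, (if x < 1 then (β ^ j)⁻¹ * (A - B) else 0) +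
        (if 0 ≤ x then (β ^ j)⁻¹ * (C - D) else 0) = (β ^ j)⁻¹ *
        (((if x < 1 then A else 0) + (if 0 ≤ x then C else 0)) -
        ((if x < 1 then B else 0) + (if 0 ≤ x then D else 0))) := by
      intro A B C D; split_ifs <;> ring
    rw [e', t1, t2]
    ring
  simp_rw [hterm] at hL
  have hR : HasSum (fun j => β * parryTerm β α (j + 1) x) (β * (parryDensity β α x -
      (Ico 0 1).indicator (fun _ => (1 : ℝ)) x)) := by
    refine HasSum.mul_left _ ?_
    have := (hasSum_nat_add_iff' (f := fun j => parryTerm β α j x) 1).2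
      (summable_parryTerm hβ x).hasSum
    simpa [parryTerm, parryDensity_eq_tsum] using this
  have hD := (((hasSum_betaDigit_sub hβ hα).mul_left β).mul_right
    ((Ico 0 1).indicator (fun _ => (1 : ℝ)) x))
  have := (hR.add hD).unique hL
  rw [← this]; ring

/-- The positive part of Parry's density. -/
def parryPos (β α x : ℝ) : ℝ := max (parryDensity β α x) 0

lemma integrable_parryPos (hβ : 1 < β) (hα : α ∈ Icc 0 (2 - β)) : Integrable (parryPos β α) := by
  have hi : IntegrableOn (parryPos β α) (Ico 0 1) := by
    refine Measure.integrableOn_of_bounded (M := ∑' j : ℕ, (β ^ j)⁻¹) (by simp)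
      ((measurable_parryDensity hβ).max measurable_const).aestronglyMeasurable
      (Eventually.of_forall fun x => ?_)
    rw [parryPos, Real.norm_eq_abs, abs_of_nonneg (le_max_right _ _)]
    exact max_le ((le_abs_self _).trans (parryDensity_le hβ x))
      ((abs_nonneg _).trans (parryDensity_le (α := α) hβ x))
  refine (integrableOn_iff_integrable_of_support_subset fun x hx => ?_).1 hi
  by_contra h
  exact hx (by simp [parryPos, parryDensity_eq_zero hβ hα h])

lemma parryPos_rightContinuous (hβ : 1 < β) (x : ℝ) :
    ContinuousWithinAt (parryPos β α) (Ici x) x :=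
  (parryDensity_rightContinuous hβ x).max continuousWithinAt_const

/-- A nonnegative right-continuous function with vanishing integral is zero. -/
lemma eq_zero_of_rightContinuous {f : ℝ → ℝ} (hf : ∀ x, ContinuousWithinAt f (Ici x) x)
    (h0 : ∀ x, 0 ≤ f x) (hi : Integrable f) (hint : ∫ x, f x = 0) (x : ℝ) : f x = 0 := by
  rw [integral_eq_zero_iff_of_nonneg h0 hi] at hint
  by_contra hx
  have hev : ∀ᶠ y in 𝓝[≥] x, f y ≠ 0 := (hf x).eventually_ne hx
  obtain ⟨u, hu, hsub⟩ := mem_nhdsGE_iff_exists_Ico_subset.1 hev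
  have hnull : volume (Ico x u) = 0 :=
    measure_mono_null hsub (by simpa [ae_iff, EventuallyEq] using hint)
  rw [Real.volume_Ico, ENNReal.ofReal_eq_zero] at hnull
  exact absurd hnull (by simpa using hu)

/-- For a positive operator, a fixed function has a positive part that is at most its own image.
Both sides have the same integral, since the two branches partition the line, so the difference
vanishes almost everywhere, and by right continuity everywhere. Working with the positive part makes
nonnegativity of the density unnecessary; `ENNReal.ofReal` discards the negative part anyway. -/
lemma parryPos_transfer (hβ : 1 < β) (hα : α ∈ Icc 0 (2 - β)) (x : ℝ) :
    β * parryPos β α x = (if x < 1 then parryPos β α ((x - α) / β) else 0) +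
      (if 0 ≤ x then parryPos β α ((x + 1 - α) / β) else 0) := by
  have hβ0 : 0 < β := by linarith
  set g := parryPos β α with hg
  have hg0 : ∀ x, 0 ≤ g x := fun x => le_max_right _ _
  have hgi : Integrable g := integrable_parryPos hβ hα
  have f1 : (fun x => if x < 1 then g ((x - α) / β) else 0) =
      fun x => (Iio ((1 - α) / β)).indicator g ((x - α) / β) := by
    ext x
    simp only [indicator, mem_Iio]
    congr 1
    rw [div_lt_div_iff_of_pos_right hβ0, eq_iff_iff]
    constructor <;> intro h <;> linarith
  have f2 : (fun x => if 0 ≤ x then g ((x + 1 - α) / β) else 0) =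
      fun x => (Ici ((1 - α) / β)).indicator g ((x - (α - 1)) / β) := by
    ext x
    rw [show x + 1 - α = x - (α - 1) by ring]
    simp only [indicator, mem_Ici]
    congr 1
    rw [div_le_div_iff_of_pos_right hβ0, eq_iff_iff]
    constructor <;> intro h <;> linarith
  have i1 : Integrable (fun x => if x < 1 then g ((x - α) / β) else 0) := by
    rw [f1]
    exact ((hgi.indicator measurableSet_Iio).comp_div hβ0.ne').comp_sub_right α
  have i2 : Integrable (fun x => if 0 ≤ x then g ((x + 1 - α) / β) else 0) := by
    rw [f2]
    exact ((hgi.indicator measurableSet_Ici).comp_div hβ0.ne').comp_sub_right (α - 1)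
  have v1 : ∫ x, (if x < 1 then g ((x - α) / β) else 0) = β * ∫ y in Iio ((1 - α) / β), g y := by
    rw [f1, integral_sub_right_eq_self (fun x => (Iio ((1 - α) / β)).indicator g (x / β)) α,
      Measure.integral_comp_div, integral_indicator measurableSet_Iio, abs_of_pos hβ0, smul_eq_mul]
  have v2 : ∫ x, (if 0 ≤ x then g ((x + 1 - α) / β) else 0) =
      β * ∫ y in Ici ((1 - α) / β), g y := by
    rw [f2, integral_sub_right_eq_self (fun x => (Ici ((1 - α) / β)).indicator g (x / β)) (α - 1),
      Measure.integral_comp_div, integral_indicator measurableSet_Ici, abs_of_pos hβ0, smul_eq_mul]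
  have hsplit : (∫ y in Iio ((1 - α) / β), g y) + ∫ y in Ici ((1 - α) / β), g y = ∫ y, g y := by
    rw [← compl_Iio]
    exact integral_add_compl measurableSet_Iio hgi
  have hrc : ∀ x, ContinuousWithinAt g (Ici x) x := parryPos_rightContinuous hβ
  have rc : ∀ (c x : ℝ), ContinuousWithinAt (fun y => g ((y - c) / β)) (Ici x) x := by
    intro c x
    refine (hrc ((x - c) / β)).comp (f := fun y => (y - c) / β)
      ((continuous_id.sub continuous_const).div_const β).continuousWithinAt fun y hy => ?_
    simp only [mem_Ici] at hy ⊢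
    gcongr
  have r1 : ∀ x, ContinuousWithinAt (fun x => if x < 1 then g ((x - α) / β) else 0) (Ici x) x := by
    intro x
    by_cases hx : x < 1
    · refine (rc α x).congr_of_eventuallyEq ?_ (by simp [hx])
      filter_upwards [Ico_mem_nhdsGE hx] with y hy
      simp [hy.2]
    · refine continuousWithinAt_const.congr (f := fun _ => (0 : ℝ)) (fun y hy => ?_) (by simp [hx])
      have : ¬ y < 1 := fun h => hx (lt_of_le_of_lt hy h)
      simp [this]
  have r2 : ∀ x, ContinuousWithinAt (fun x => if 0 ≤ x then g ((x + 1 - α) / β) else 0)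
      (Ici x) x := by
    intro x
    by_cases hx : 0 ≤ x
    · refine (rc (α - 1) x).congr (fun y hy => ?_) ?_
      · have : 0 ≤ y := hx.trans hy
        simp only [this, if_true]; congr 2; ring
      · simp only [hx, if_true]; congr 2; ring
    · refine continuousWithinAt_const.congr_of_eventuallyEq (f := fun _ => (0 : ℝ)) ?_ (by simp [hx])
      filter_upwards [Ico_mem_nhdsGE (not_le.1 hx)] with y hy
      simp [not_le.2 hy.2]
  have key := eq_zero_of_rightContinuous
    (f := fun x => (if x < 1 then g ((x - α) / β) else 0) +
      (if 0 ≤ x then g ((x + 1 - α) / β) else 0) - β * g x)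
    (fun x => ((r1 x).add (r2 x)).sub ((hrc x).const_mul β)) (fun x => ?_)
    ((i1.add i2).sub (hgi.const_mul β)) ?_ x
  · linarith
  · have ht := parryDensity_transfer hβ hα x
    have hle : ∀ y, parryDensity β α y ≤ g y := fun y => le_max_left _ _
    have a1 : 0 ≤ (if x < 1 then g ((x - α) / β) else 0) := by split_ifs <;> simp [hg0]
    have a2 : 0 ≤ (if 0 ≤ x then g ((x + 1 - α) / β) else 0) := by split_ifs <;> simp [hg0]
    have b1 : (if x < 1 then parryDensity β α ((x - α) / β) else 0) ≤
      (if x < 1 then g ((x - α) / β) else 0) := by split_ifs <;> simp [hle]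
    have b2 : (if 0 ≤ x then parryDensity β α ((x + 1 - α) / β) else 0) ≤
      (if 0 ≤ x then g ((x + 1 - α) / β) else 0) := by split_ifs <;> simp [hle]
    rw [sub_nonneg, hg, parryPos, mul_max_of_nonneg _ _ hβ0.le, ht, mul_zero]
    exact max_le (add_le_add b1 b2) (add_nonneg a1 a2)
  · have e := integral_sub (i1.add i2) (hgi.const_mul β)
    rw [integral_add' i1 i2, v1, v2, integral_const_mul, ← mul_add, hsplit, sub_self] at e
    exact e

/-- The set where Parry's density is positive is forward invariant. -/
lemma parryDensity_pos_Tplus (hβ : 1 < β) (hα : α ∈ Icc 0 (2 - β)) {y : ℝ}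
    (hy : 0 < parryDensity β α y) : 0 < parryDensity β α (Tplus β α y) := by
  have hβ0 : 0 < β := by linarith
  have hg0 : ∀ x, 0 ≤ parryPos β α x := fun x => le_max_right _ _
  have hy' : 0 < parryPos β α y := lt_max_of_lt_left hy
  -- The point `y` is one of the two preimages of its image, and the other preimage contributes a
  -- nonnegative summand.
  have ht := parryPos_transfer hβ hα (Tplus β α y)
  have a1 : 0 ≤ (if Tplus β α y < 1 then parryPos β α ((Tplus β α y - α) / β) else 0) := by
    split_ifs <;> simp [hg0]
  have a2 : 0 ≤ (if 0 ≤ Tplus β α y then parryPos β α ((Tplus β α y + 1 - α) / β) else 0) := by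
    split_ifs <;> simp [hg0]
  have hpos : 0 < parryPos β α (Tplus β α y) := by
    by_cases h : y < (1 - α) / β
    · have e : Tplus β α y = β * y + α := by simp [Tplus, h]
      have e1 : (Tplus β α y - α) / β = y := by rw [e]; field_simp; ring
      have e2 : Tplus β α y < 1 := by rw [e]; rw [lt_div_iff₀ hβ0] at h; linarith
      rw [if_pos e2, e1] at ht
      nlinarith
    · have e : Tplus β α y = β * y + α - 1 := by simp [Tplus, h]
      have e1 : (Tplus β α y + 1 - α) / β = y := by rw [e]; field_simp; ring
      have e2 : 0 ≤ Tplus β α y := by rw [e]; rw [not_lt, div_le_iff₀ hβ0] at h; linarith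
      rw [if_pos e2, e1] at ht
      nlinarith
  rcases lt_max_iff.1 hpos with h | h
  exacts [h, absurd h (lt_irrefl _)]

lemma parryDensity_pos_iterate (hβ : 1 < β) (hα : α ∈ Icc 0 (2 - β)) {y : ℝ}
    (hy : 0 < parryDensity β α y) (j : ℕ) : 0 < parryDensity β α ((Tplus β α)^[j] y) := by
  induction j with
  | zero => exact hy
  | succ j ih => rw [Function.iterate_succ_apply']; exact parryDensity_pos_Tplus hβ hα ih

/-- The total mass is finite because the density is bounded with bounded support, and nonzero
because of the left limit at the discontinuity; hence the normalising factor is harmless. -/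
lemma parryMeasure_support_eq (hβ : 1 < β) (hα : α ∈ Icc 0 (2 - β)) :
    (parryMeasure β α).support = (parryMeasureAux β α).support := by
  have hβ0 : 0 < β := by linarith
  have hfin : parryMeasureAux β α univ ≠ ⊤ := by
    have h := (integrable_parryPos hβ hα).lintegral_lt_top
    rw [parryMeasureAux, withDensity_apply _ MeasurableSet.univ, Measure.restrict_univ]
    refine ne_of_lt (lt_of_le_of_lt (lintegral_mono fun x => ?_) h)
    exact ENNReal.ofReal_le_ofReal (le_max_left _ _)
  have h0 : (parryMeasureAux β α univ)⁻¹ ≠ 0 := ENNReal.inv_ne_zero.2 hfin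
  have hpos : parryMeasureAux β α univ ≠ 0 := by
    have hev : ∀ᶠ y in 𝓝[<] ((1 - α) / β), 0 < parryDensity β α y :=
      (parryDensity_tendsto_left hβ hα).eventually_const_lt hβ0
    obtain ⟨u, hu, hsub⟩ := mem_nhdsLT_iff_exists_Ioo_subset.1 hev
    intro h
    rw [parryMeasureAux, withDensity_apply _ MeasurableSet.univ, Measure.restrict_univ,
      lintegral_eq_zero_iff (measurable_parryDensity hβ).ennreal_ofReal] at h
    have hnull : volume (Ioo u ((1 - α) / β)) = 0 := by
      refine measure_mono_null (fun y hy => ?_) (ae_iff.1 h)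
      simpa using hsub hy
    rw [Real.volume_Ioo, ENNReal.ofReal_eq_zero] at hnull
    exact absurd hnull (by simpa using hu)
  ext x
  simp only [Measure.mem_support_iff_forall, parryMeasure, Measure.smul_apply, smul_eq_mul]
  refine forall₂_congr fun U _ => ?_
  rw [pos_iff_ne_zero, pos_iff_ne_zero, mul_ne_zero_iff]
  exact ⟨fun h => h.2, fun h => ⟨h0, h⟩⟩

end

/-! ### Forward invariant sets containing an interval. -/

section
variable {β α : ℝ} {Q : Set ℝ}

lemma Ioo_subset_left_branch (hβ : 1 < β) (hα : α ∈ Icc 0 (2 - β))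
    (hQ : ∀ y ∈ Icc (0 : ℝ) 1, y ∈ Q → Tplus β α y ∈ Q) {u v : ℝ} (hu : 0 ≤ u)
    (hv : v ≤ (1 - α) / β) (h : Ioo u v ⊆ Q) : Ioo (β * u + α) (β * v + α) ⊆ Q := by
  have hβ0 : 0 < β := by linarith
  rintro x ⟨h1, h2⟩
  have hy1 : u < (x - α) / β := by rw [lt_div_iff₀ hβ0]; linarith
  have hy2 : (x - α) / β < v := by rw [div_lt_iff₀ hβ0]; linarith
  have hp : (1 - α) / β ≤ 1 := by rw [div_le_one hβ0]; linarith [hα.1]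
  have := hQ ((x - α) / β) ⟨by linarith, by linarith⟩ (h ⟨hy1, hy2⟩)
  rw [Tplus, if_pos (by linarith)] at this
  convert this using 1
  field_simp; ring

lemma Ioo_subset_right_branch (hβ : 1 < β) (hα : α ∈ Icc 0 (2 - β))
    (hQ : ∀ y ∈ Icc (0 : ℝ) 1, y ∈ Q → Tplus β α y ∈ Q) {u v : ℝ} (hu : (1 - α) / β ≤ u)
    (hv : v ≤ 1) (h : Ioo u v ⊆ Q) : Ioo (β * u + α - 1) (β * v + α - 1) ⊆ Q := by
  have hβ0 : 0 < β := by linarith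
  rintro x ⟨h1, h2⟩
  have hy1 : u < (x + 1 - α) / β := by rw [lt_div_iff₀ hβ0]; linarith
  have hy2 : (x + 1 - α) / β < v := by rw [div_lt_iff₀ hβ0]; linarith
  have hp : 0 ≤ (1 - α) / β := div_nonneg (by linarith [hα.2]) hβ0.le
  have := hQ ((x + 1 - α) / β) ⟨by linarith, by linarith⟩ (h ⟨hy1, hy2⟩)
  rw [Tplus, if_neg (by linarith)] at this
  convert this using 1
  field_simp; ring

/-- The image of `(0,p)` is `(α,1)`. As long as the interval `(z,1)` does not overlap `(0,w)`, it
lies in the right branch, and adjoining its image moves the left end down by at least `(β-1)(1-α)`;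
this bound is where `α ≤ 2 - β` enters. After finitely many steps the two intervals overlap. -/
lemma unit_subset_of_initial (hβ : 1 < β) (hα : α ∈ Icc 0 (2 - β))
    (hQ : ∀ y ∈ Icc (0 : ℝ) 1, y ∈ Q → Tplus β α y ∈ Q) {w : ℝ} (hw : (1 - α) / β < w)
    (h : Ioo 0 w ⊆ Q) : Ioo 0 1 ⊆ Q := by
  have hβ0 : 0 < β := by linarith
  obtain ⟨h0, h2⟩ := id hα
  have hp : β * ((1 - α) / β) = 1 - α := by field_simp
  have hstart : Ioo α 1 ⊆ Q := by
    have := Ioo_subset_left_branch hβ hα hQ le_rfl le_rfl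
      ((Ioo_subset_Ioo_right hw.le).trans h)
    rwa [hp, mul_zero, zero_add, sub_add_cancel] at this
  have main : ∀ N : ℕ, Ioo 0 1 ⊆ Q ∨
      ∃ z, z ≤ α - N * ((β - 1) * (1 - α)) ∧ Ioo z 1 ⊆ Q := by
    intro N
    induction N with
    | zero => exact Or.inr ⟨α, by simp, hstart⟩
    | succ N ih =>
      rcases ih with h' | ⟨z, hz, hzQ⟩
      · exact Or.inl h'
      by_cases hzw : z < w
      · left
        intro x hx
        by_cases hxw : x < w
        · exact h ⟨hx.1, hxw⟩
        · exact hzQ ⟨by linarith, hx.2⟩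
      · right
        have hδ : 0 ≤ (N : ℝ) * ((β - 1) * (1 - α)) :=
          mul_nonneg N.cast_nonneg (mul_nonneg (by linarith) (by linarith))
        refine ⟨β * z + α - 1, ?_, ?_⟩
        · push_cast
          nlinarith [mul_nonneg (sub_nonneg.2 hβ.le) (show 0 ≤ α - z by linarith)]
        · have himg := Ioo_subset_right_branch hβ hα hQ (by linarith) le_rfl hzQ
          rintro x ⟨hx1, hx2⟩
          by_cases hxz : z < x
          · exact hzQ ⟨hxz, hx2⟩
          · exact himg ⟨hx1, by linarith⟩
  have hpos : 0 < (β - 1) * (1 - α) := mul_pos (by linarith) (by linarith)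
  obtain ⟨N, hN⟩ := exists_nat_gt (α / ((β - 1) * (1 - α)))
  rw [div_lt_iff₀ hpos] at hN
  rcases main N with h' | ⟨z, hz, hzQ⟩
  · exact h'
  · exact (Ioo_subset_Ioo_left (by linarith)).trans hzQ

/-- Mirror image of `unit_subset_of_initial`: an interval `(0,z)` grows from `z = β + α - 1` until
it meets `(w,1)`. -/
lemma unit_subset_of_final (hβ : 1 < β) (hα : α ∈ Icc 0 (2 - β))
    (hQ : ∀ y ∈ Icc (0 : ℝ) 1, y ∈ Q → Tplus β α y ∈ Q) {w : ℝ} (hw : w < (1 - α) / β)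
    (h : Ioo w 1 ⊆ Q) : Ioo 0 1 ⊆ Q := by
  have hβ0 : 0 < β := by linarith
  obtain ⟨h0, h2⟩ := id hα
  have hp : β * ((1 - α) / β) = 1 - α := by field_simp
  have hstart : Ioo 0 (β + α - 1) ⊆ Q := by
    have := Ioo_subset_right_branch hβ hα hQ le_rfl le_rfl
      ((Ioo_subset_Ioo_left hw.le).trans h)
    rwa [hp, mul_one, sub_add_cancel, sub_self] at this
  have hpos : 0 < (β - 1) * (β + α - 1) := mul_pos (by linarith) (by linarith)
  have main : ∀ N : ℕ, Ioo 0 1 ⊆ Q ∨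
      ∃ z, (β + α - 1) + N * ((β - 1) * (β + α - 1)) ≤ z ∧ Ioo 0 z ⊆ Q := by
    intro N
    induction N with
    | zero => exact Or.inr ⟨β + α - 1, by simp, hstart⟩
    | succ N ih =>
      rcases ih with h' | ⟨z, hz, hzQ⟩
      · exact Or.inl h'
      by_cases hzw : w < z
      · left
        intro x hx
        by_cases hxw : w < x
        · exact h ⟨hxw, hx.2⟩
        · exact hzQ ⟨hx.1, by linarith⟩
      · right
        have hδ : 0 ≤ (N : ℝ) * ((β - 1) * (β + α - 1)) :=
          mul_nonneg N.cast_nonneg hpos.le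
        refine ⟨β * z + α, ?_, ?_⟩
        · push_cast
          nlinarith [mul_nonneg (sub_nonneg.2 hβ.le) (show 0 ≤ z - (β + α - 1) by linarith)]
        · have himg := Ioo_subset_left_branch hβ hα hQ le_rfl (by linarith) hzQ
          rintro x ⟨hx1, hx2⟩
          by_cases hxz : x < z
          · exact hzQ ⟨hx1, hxz⟩
          · exact himg ⟨by linarith, hx2⟩
  obtain ⟨N, hN⟩ := exists_nat_gt (1 / ((β - 1) * (β + α - 1)))
  rw [div_lt_iff₀ hpos] at hN
  rcases main N with h' | ⟨z, hz, hzQ⟩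
  · exact h'
  · exact (Ioo_subset_Ioo_right (by linarith)).trans hzQ

/-- An interval missing the discontinuity is stretched by `β ≥ β²/2`. Otherwise its longer half has
an image ending at `0` or `1`. If that image crosses the discontinuity, one of the two preceding
lemmas finishes; if not, a second application stretches the half by `β²` in total, hence the whole
by `β²/2`, which exceeds `1` exactly for `β > √2`. -/
lemma exists_longer_Ioo (hβ : √2 < β) (hα : α ∈ Icc 0 (2 - β))
    (hQ : ∀ y ∈ Icc (0 : ℝ) 1, y ∈ Q → Tplus β α y ∈ Q) {u v : ℝ} (hu : 0 ≤ u) (huv : u < v)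
    (hv : v ≤ 1) (h : Ioo u v ⊆ Q) :
    Ioo 0 1 ⊆ Q ∨ ∃ u' v', 0 ≤ u' ∧ v' ≤ 1 ∧ β ^ 2 / 2 * (v - u) ≤ v' - u' ∧ Ioo u' v' ⊆ Q := by
  have hβ1 : 1 < β := (Real.one_lt_sqrt_two).trans hβ
  have hβ0 : 0 < β := by linarith
  obtain ⟨h0, h2⟩ := id hα
  have hβ2 : β ^ 2 / 2 ≤ β := by nlinarith
  have hp : β * ((1 - α) / β) = 1 - α := by field_simp
  set p := (1 - α) / β with hpdef
  have hlen : β ^ 2 / 2 * (v - u) ≤ β * (v - u) :=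
    mul_le_mul_of_nonneg_right hβ2 (by linarith)
  by_cases hvp : v ≤ p
  · right
    exact ⟨_, _, by positivity, by nlinarith, by linarith,
      Ioo_subset_left_branch hβ1 hα hQ hu hvp h⟩
  by_cases hpu : p ≤ u
  · right
    exact ⟨_, _, by nlinarith, by nlinarith, by linarith,
      Ioo_subset_right_branch hβ1 hα hQ hpu hv h⟩
  rw [not_le] at hvp hpu
  by_cases hhalf : p - u ≤ v - p
  · have hI := Ioo_subset_right_branch hβ1 hα hQ le_rfl hv ((Ioo_subset_Ioo_left hpu.le).trans h)
    rw [← hpdef, hp, sub_add_cancel, sub_self] at hI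
    by_cases hw : p < β * v + α - 1
    · exact Or.inl (unit_subset_of_initial hβ1 hα hQ hw hI)
    · right
      refine ⟨_, _, ?_, ?_, ?_, Ioo_subset_left_branch hβ1 hα hQ le_rfl (not_lt.1 hw) hI⟩
      · linarith
      · nlinarith
      · nlinarith [mul_le_mul_of_nonneg_left hhalf (sq_nonneg β)]
  · have hI := Ioo_subset_left_branch hβ1 hα hQ hu le_rfl ((Ioo_subset_Ioo_right hvp.le).trans h)
    rw [← hpdef, hp, sub_add_cancel] at hI
    by_cases hw : β * u + α < p
    · exact Or.inl (unit_subset_of_final hβ1 hα hQ hw hI)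
    · right
      refine ⟨_, _, ?_, ?_, ?_, Ioo_subset_right_branch hβ1 hα hQ (not_lt.1 hw) le_rfl hI⟩
      · nlinarith
      · linarith
      · nlinarith [mul_le_mul_of_nonneg_left (not_le.1 hhalf).le (sq_nonneg β)]

/-- For `β > √2`, a forward invariant set containing an interval contains `(0, 1)`. -/
lemma unit_subset_of_sqrt_two_lt (hβ : √2 < β) (hα : α ∈ Icc 0 (2 - β))
    (hQ : ∀ y ∈ Icc (0 : ℝ) 1, y ∈ Q → Tplus β α y ∈ Q) {u v : ℝ} (hu : 0 ≤ u) (huv : u < v)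
    (hv : v ≤ 1) (h : Ioo u v ⊆ Q) : Ioo 0 1 ⊆ Q := by
  have hr : 1 < β ^ 2 / 2 := by
    have := Real.lt_sq_of_sqrt_lt hβ
    linarith
  have main : ∀ N : ℕ, Ioo 0 1 ⊆ Q ∨
      ∃ u' v', 0 ≤ u' ∧ v' ≤ 1 ∧ (β ^ 2 / 2) ^ N * (v - u) ≤ v' - u' ∧ Ioo u' v' ⊆ Q := by
    intro N
    induction N with
    | zero => exact Or.inr ⟨u, v, hu, hv, by simp, h⟩
    | succ N ih =>
      rcases ih with h' | ⟨u', v', hu', hv', hlen, hI⟩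
      · exact Or.inl h'
      have hpos : 0 < (β ^ 2 / 2) ^ N * (v - u) := mul_pos (by positivity) (by linarith)
      rcases exists_longer_Ioo hβ hα hQ hu' (by linarith) hv' hI with h' | ⟨x, y, hx, hy, hl, hI'⟩
      · exact Or.inl h'
      · refine Or.inr ⟨x, y, hx, hy, le_trans ?_ hl, hI'⟩
        rw [pow_succ', mul_assoc]
        exact mul_le_mul_of_nonneg_left hlen (by linarith)
  obtain ⟨N, hN⟩ := pow_unbounded_of_one_lt (1 / (v - u)) hr
  rw [div_lt_iff₀ (by linarith)] at hN
  rcases main N with h' | ⟨x, y, hx, hy, hl, -⟩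
  · exact h'
  · linarith

lemma Tplus_eq_Tminus_of_ne {x : ℝ} (hx : x ≠ (1 - α) / β) : Tplus β α x = Tminus β α x := by
  unfold Tplus Tminus
  rcases lt_or_gt_of_ne hx with h | h
  · rw [if_pos h, if_pos h.le]
  · rw [if_neg h.not_gt, if_neg h.not_ge]

lemma Tminus_discontinuity (hβ : 1 < β) : Tminus β α ((1 - α) / β) = 1 := by
  rw [Tminus, if_pos le_rfl]; field_simp; ring

/-- An orbit of `Tminus` agrees with the orbit of `Tplus` until it runs into the orbit of `1`. -/
lemma Tminus_iterate_eq_or (hβ : 1 < β) (x : ℝ) (j : ℕ) :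
    (Tminus β α)^[j] x = (Tplus β α)^[j] x ∨ ∃ l, (Tminus β α)^[j] x = (Tminus β α)^[l] 1 := by
  induction j with
  | zero => exact Or.inl rfl
  | succ j ih =>
    rw [Function.iterate_succ_apply', Function.iterate_succ_apply']
    rcases ih with h | ⟨l, hl⟩
    · by_cases hx : (Tminus β α)^[j] x = (1 - α) / β
      · right
        exact ⟨0, by rw [hx, Tminus_discontinuity hβ]; rfl⟩
      · left
        rw [← Tplus_eq_Tminus_of_ne hx, h]
    · right
      exact ⟨l + 1, by rw [hl, Function.iterate_succ_apply']⟩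

/-- Under the hypotheses of the main theorem, a `Tplus`-invariant set containing an interval
contains `(0, 1)` up to countably many points. -/
lemma exists_countable_unit_diff_subset (hβ : 1 < β) (hα : α ∈ Icc 0 (2 - β))
    (hT : √2 < β ∨ IsTransitiveOnUnit (Tplus β α) ∨ IsTransitiveOnUnit (Tminus β α))
    (hQ : ∀ y ∈ Icc (0 : ℝ) 1, y ∈ Q → Tplus β α y ∈ Q) {u v : ℝ} (hu : 0 ≤ u) (huv : u < v)
    (hv : v ≤ 1) (h : Ioo u v ⊆ Q) : ∃ C : Set ℝ, C.Countable ∧ Ioo 0 1 \ C ⊆ Q := by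
  have hiter : ∀ y ∈ Ioo u v, ∀ j, (Tplus β α)^[j] y ∈ Q := by
    intro y hy j
    induction j with
    | zero => exact h hy
    | succ j ih =>
      rw [Function.iterate_succ_apply']
      exact hQ _ (Tplus_iterate_mem_Icc hβ hα ⟨hu.trans hy.1.le, hy.2.le.trans hv⟩ j) ih
  rcases hT with hT | hT | hT
  · exact ⟨∅, countable_empty,
      sdiff_subset.trans (unit_subset_of_sqrt_two_lt hT hα hQ hu huv hv h)⟩
  · refine ⟨∅, countable_empty, sdiff_subset.trans fun x hx => ?_⟩
    obtain ⟨m, hm⟩ := hT u v hu huv hv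
    obtain ⟨j, -, y, hy, rfl⟩ := mem_iUnion₂.1 (hm hx)
    exact hiter y hy j
  · refine ⟨range fun l => (Tminus β α)^[l] 1, countable_range _, ?_⟩
    rintro x ⟨hx, hxC⟩
    obtain ⟨m, hm⟩ := hT u v hu huv hv
    obtain ⟨j, -, y, hy, rfl⟩ := mem_iUnion₂.1 (hm hx)
    rcases Tminus_iterate_eq_or hβ y j with h' | ⟨l, hl⟩
    · rw [h']; exact hiter y hy j
    · exact absurd ⟨l, hl.symm⟩ hxC

end

/-! ### The tiling of the circle and the renormalisation tower. -/

/-- The hypotheses under which `Tplus b a` is a renormalisation of `Tplus β α` along the rotation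
by `k / n`. -/
structure RotationData (n k : ℕ) (b a β α : ℝ) : Prop where
  one_le : 1 ≤ k
  lt : k < n
  coprime : Nat.gcd n k = 1
  one_lt : 1 < b
  pow_eq : b ^ n = β
  mem_Icc : α ∈ Icc 0 (2 - β)
  -- The defining formula of `renormParam` with denominators cleared and `W` rewritten by
  -- `mul_sum_pow_div`. It is the condition that makes the tower levels map onto one another.
  param : a * b * ∑ i ∈ Finset.range n, b ^ i =
    (∑ i ∈ Finset.range n, b ^ i * ((i * k / n : ℕ) : ℝ)) * (1 - b) + β * (k - 1) + 1 +
      (b - 1) * α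

/-- The weighted number of points of the rotation orbit below `m`, in normalisation where the
point `(i + 1) k` has weight `b ^ i`. -/
def rotationCount (n k : ℕ) (b : ℝ) (m : ℤ) : ℝ :=
  ∑ i ∈ Finset.range n, b ^ i * (((m - 1 - ((i : ℤ) + 1) * k) / (n : ℤ) : ℤ) : ℝ)

/-- The left end point of the tile number `m` of the tiling of the circle by the levels of the
renormalisation tower. -/
def tileLeft (n k : ℕ) (b a α : ℝ) (m : ℤ) : ℝ :=
  (rotationCount n k b m - rotationCount n k b k - α) / (∑ i ∈ Finset.range n, b ^ i) + a

/-- The affine parametrisation of the `i`-th level of the renormalisation tower. -/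
def towerMap (n k : ℕ) (b a α : ℝ) (i : ℕ) (x : ℝ) : ℝ :=
  tileLeft n k b a α ((i + 1 : ℕ) * k : ℤ) - (((i + 1) * k / n : ℕ) : ℝ) +
    b ^ i * ((b - 1) * x + α / ∑ i ∈ Finset.range n, b ^ i)

lemma Int.ediv_eq_of_le_of_lt {x n q : ℤ} (hn : 0 < n) (h1 : q * n ≤ x) (h2 : x < (q + 1) * n) :
    x / n = q := by
  apply le_antisymm
  · exact Int.lt_add_one_iff.1 (Int.ediv_lt_of_lt_mul hn h2)
  · exact Int.le_ediv_of_mul_le hn h1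

lemma Nat.lt_div_succ_mul {n : ℕ} (hn : 0 < n) (m : ℕ) : m < (m / n + 1) * n := by
  rw [add_mul, one_mul]; exact Nat.lt_div_mul_add hn

section
variable {n k : ℕ} {b a β α : ℝ}

lemma rotationCount_add_period (hn : 0 < n) (m t : ℤ) :
    rotationCount n k b (m + n * t) =
      rotationCount n k b m + t * ∑ i ∈ Finset.range n, b ^ i := by
  unfold rotationCount
  rw [Finset.mul_sum, ← Finset.sum_add_distrib]
  refine Finset.sum_congr rfl fun i _ => ?_
  rw [show m + n * t - 1 - ((i : ℤ) + 1) * k = (m - 1 - ((i : ℤ) + 1) * k) + n * t by ring,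
    Int.add_mul_ediv_left _ _ (by exact_mod_cast hn.ne')]
  push_cast; ring

/-- A shift by `k` moves each orbit point to its successor and so multiplies its weight by `b`; the
remaining terms are the mismatch at the two ends of the orbit, of weights `1` and `b ^ n`. -/
lemma rotationCount_add_rotation (hn : 0 < n) (m : ℤ) :
    rotationCount n k b (m + k) = b * rotationCount n k b m +
      (((m - 1) / (n : ℤ) : ℤ) : ℝ) * (1 - b ^ n) + k * b ^ n := by
  unfold rotationCount
  obtain ⟨N, rfl⟩ : ∃ N, n = N + 1 := ⟨n - 1, by omega⟩
  rw [Finset.sum_range_succ', Finset.sum_range_succ, mul_add, Finset.mul_sum]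
  have e : ((m - 1 - ((N : ℤ) + 1) * k) / ((N + 1 : ℕ) : ℤ)) =
      (m - 1) / ((N + 1 : ℕ) : ℤ) - k := by
    rw [show m - 1 - ((N : ℤ) + 1) * k = m - 1 + ((N + 1 : ℕ) : ℤ) * (-k) by push_cast; ring,
      Int.add_mul_ediv_left _ _ (by positivity)]
    ring
  rw [e]
  have e2 : ∀ i : ℕ, m + k - 1 - (((i + 1 : ℕ) : ℤ) + 1) * k = m - 1 - ((i : ℤ) + 1) * k := by
    intro i; push_cast; ring
  simp_rw [e2]
  rw [show m + k - 1 - (((0 : ℕ) : ℤ) + 1) * k = m - 1 by push_cast; ring]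
  have e3 : ∀ i : ℕ, b ^ (i + 1) * (((m - 1 - ((i : ℤ) + 1) * k) / ((N + 1 : ℕ) : ℤ) : ℤ) : ℝ) =
      b * (b ^ i * (((m - 1 - ((i : ℤ) + 1) * k) / ((N + 1 : ℕ) : ℤ) : ℤ) : ℝ)) := by
    intro i; ring
  simp_rw [e3]
  push_cast
  ring

lemma rotationCount_mono (hn : 0 < n) (hb : 0 < b) : Monotone (rotationCount n k b) := by
  intro m m' h
  refine Finset.sum_le_sum fun i _ => mul_le_mul_of_nonneg_left ?_ (by positivity)
  exact_mod_cast Int.ediv_le_ediv (by exact_mod_cast hn) (by linarith)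

/-- The `i`-th floor jumps here and no other floor decreases. This bounds the length of a tile from
below, which is all the tower needs. -/
lemma le_rotationCount_succ_sub (hb : 0 < b) {i : ℕ} (hi : i < n) (t : ℤ) :
    b ^ i ≤ rotationCount n k b ((i + 1 : ℕ) * k + n * t + 1) -
      rotationCount n k b ((i + 1 : ℕ) * k + n * t) := by
  have hn : 0 < n := by omega
  unfold rotationCount
  rw [← Finset.sum_sub_distrib]
  have hterm : ∀ m : ℤ, ∀ j ∈ Finset.range n,
      0 ≤ b ^ j * (((m + 1 - 1 - ((j : ℤ) + 1) * k) / (n : ℤ) : ℤ) : ℝ) -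
        b ^ j * (((m - 1 - ((j : ℤ) + 1) * k) / (n : ℤ) : ℤ) : ℝ) := by
    intro m j _
    rw [← mul_sub]
    refine mul_nonneg (by positivity) (sub_nonneg.2 ?_)
    exact_mod_cast Int.ediv_le_ediv (by exact_mod_cast hn) (by linarith)
  refine le_trans ?_ (Finset.single_le_sum (hterm _) (Finset.mem_range.2 hi))
  have hn' : (0 : ℤ) < n := by exact_mod_cast hn
  rw [Int.ediv_eq_of_le_of_lt (q := t) hn' (by push_cast; linarith) (by push_cast; linarith),
    Int.ediv_eq_of_le_of_lt (q := t - 1) hn' (by push_cast; linarith) (by push_cast; linarith)]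
  push_cast
  linarith

lemma rotationCount_rotation (hn : 0 < n) :
    rotationCount n k b k = - (∑ i ∈ Finset.range n, b ^ i) -
      ∑ i ∈ Finset.range n, b ^ i * ((i * k / n : ℕ) : ℝ) := by
  unfold rotationCount
  rw [← Finset.sum_neg_distrib, ← Finset.sum_sub_distrib]
  refine Finset.sum_congr rfl fun i _ => ?_
  have hn' : (0 : ℤ) < n := by exact_mod_cast hn
  have h1 : i * k / n * n ≤ i * k := Nat.div_mul_le_self _ _
  have h2 : i * k < (i * k / n + 1) * n := 
    Nat.lt_div_succ_mul hn _
  zify at h1 h2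
  rw [Int.ediv_eq_of_le_of_lt (q := -1 - ((i * k / n : ℕ) : ℤ)) hn' (by push_cast; linarith)
    (by push_cast; linarith)]
  simp only [Int.cast_sub, Int.cast_neg, Int.cast_one, Int.cast_natCast]
  ring

namespace RotationData

lemma n_pos (h : RotationData n k b a β α) : 0 < n := by have := h.lt; omega

lemma b_pos (h : RotationData n k b a β α) : 0 < b := by linarith [h.one_lt]

lemma geom_pos (h : RotationData n k b a β α) : 0 < ∑ i ∈ Finset.range n, b ^ i :=
  Finset.sum_pos (fun i _ => pow_pos h.b_pos i) ⟨0, Finset.mem_range.2 h.n_pos⟩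

lemma geom_mul (h : RotationData n k b a β α) :
    (b - 1) * ∑ i ∈ Finset.range n, b ^ i = β - 1 := by
  rw [mul_geom_sum, h.pow_eq]

lemma beta_gt (h : RotationData n k b a β α) : 1 < β := by
  rw [← h.pow_eq]; exact one_lt_pow₀ h.one_lt h.n_pos.ne'

lemma div_lt_div_succ (h : RotationData n k b a β α) (i : ℕ) :
    (i + 1) * k / n ≤ i * k / n + 1 := by
  rw [← Nat.add_div_right _ h.n_pos]
  exact Nat.div_le_div_right (by have := h.lt; nlinarith)

lemma pred_mul_div (h : RotationData n k b a β α) : (n - 1) * k / n = k - 1 := by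
  have h1 := h.one_le
  have h2 := h.lt
  obtain ⟨K, rfl⟩ : ∃ K, k = K + 1 := ⟨k - 1, by omega⟩
  obtain ⟨N, rfl⟩ : ∃ N, n = N + 1 := ⟨n - 1, by omega⟩
  simp only [Nat.add_sub_cancel]
  apply Nat.div_eq_of_lt_le <;> nlinarith

lemma tileLeft_mono (h : RotationData n k b a β α) : Monotone (tileLeft n k b a α) := by
  intro m m' hm
  have := rotationCount_mono (k := k) h.n_pos h.b_pos hm
  have hS := h.geom_pos
  unfold tileLeft
  gcongr

lemma tileLeft_add_period (h : RotationData n k b a β α) (m t : ℤ) :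
    tileLeft n k b a α (m + n * t) = tileLeft n k b a α m + t := by
  have hS := h.geom_pos
  unfold tileLeft
  rw [rotationCount_add_period h.n_pos]
  field_simp
  ring

/-- Locates the tile that carries level `n - 1`, up to an integer translation by `k`; it is used to
compute the return to level `0`. -/
lemma tileLeft_zero (h : RotationData n k b a β α) :
    b * (∑ i ∈ Finset.range n, b ^ i) * tileLeft n k b a α 0 = 1 - β - α := by
  have hS := h.geom_pos
  have h1 := rotationCount_add_rotation (k := k) (b := b) h.n_pos 0
  have hn : (0 : ℤ) < n := by exact_mod_cast h.n_pos
  rw [zero_add, Int.ediv_eq_of_le_of_lt (q := -1) hn (by linarith) (by linarith), h.pow_eq] at h1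
  have h2 := rotationCount_rotation (k := k) (b := b) h.n_pos
  have h3 := h.param
  have h4 := h.geom_mul
  unfold tileLeft
  generalize (∑ i ∈ Finset.range n, b ^ i) = S at *
  generalize (∑ i ∈ Finset.range n, b ^ i * ((i * k / n : ℕ) : ℝ)) = Y at *
  have e : b * S * ((rotationCount n k b 0 - rotationCount n k b k - α) / S + a) =
      b * (rotationCount n k b 0 - rotationCount n k b k - α) + a * b * S := by
    field_simp
  rw [e, h3]
  push_cast at h1
  rw [h2] at h1 ⊢
  linear_combination -h1 + h4

lemma towerMap_zero (h : RotationData n k b a β α) (x : ℝ) :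
    towerMap n k b a α 0 x = (b - 1) * x + a := by
  have hS := h.geom_pos
  unfold towerMap tileLeft
  rw [show (0 + 1) * k / n = 0 by rw [zero_add, one_mul]; exact Nat.div_eq_of_lt h.lt]
  push_cast
  rw [one_mul]
  field_simp
  ring

lemma towerMap_sub (i : ℕ) (x y : ℝ) :
    towerMap n k b a α i x - towerMap n k b a α i y = b ^ i * (b - 1) * (x - y) := by
  unfold towerMap; ring

/-- The jump of the floor is the branch digit. The left ends of the tiles match by
`rotationCount_add_rotation`, and the remaining constant vanishes by `param`. -/
lemma towerMap_succ (h : RotationData n k b a β α) {i : ℕ} (hi : i + 1 < n) (x : ℝ) :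
    towerMap n k b a α (i + 1) x = b * towerMap n k b a α i x + a -
      ((((i + 2) * k / n : ℕ) : ℝ) - (((i + 1) * k / n : ℕ) : ℝ)) := by
  have hS := h.geom_pos
  have hn : (0 : ℤ) < n := by exact_mod_cast h.n_pos
  have h1 := rotationCount_add_rotation (k := k) (b := b) h.n_pos ((i + 1 : ℕ) * k)
  have hnd : ¬ n ∣ (i + 1) * k := by
    intro hd
    have := (Nat.Coprime.dvd_of_dvd_mul_right h.coprime hd)
    exact absurd (Nat.le_of_dvd (by omega) this) (by omega)
  have hq : (((i + 1 : ℕ) * k : ℤ) - 1) / n = (((i + 1) * k / n : ℕ) : ℤ) := by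
    have u1 : (i + 1) * k / n * n < (i + 1) * k :=
      lt_of_le_of_ne (Nat.div_mul_le_self _ _) fun he => hnd ⟨_, by rw [mul_comm n, he]⟩
    have u2 : (i + 1) * k < ((i + 1) * k / n + 1) * n := 
      Nat.lt_div_succ_mul h.n_pos _
    zify at u1 u2
    apply Int.ediv_eq_of_le_of_lt hn
    · push_cast; linarith
    · push_cast; linarith
  rw [hq, h.pow_eq] at h1
  have h2 := rotationCount_rotation (k := k) (b := b) h.n_pos
  have h3 := h.param
  have h4 := h.geom_mul
  unfold towerMap tileLeft
  rw [show (((i + 1 + 1 : ℕ) : ℤ) * k) = ((i + 1 : ℕ) : ℤ) * k + k by push_cast; ring, h1]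
  rw [Int.cast_natCast]
  rw [show i + 1 + 1 = i + 2 by ring]
  generalize (((i + 2) * k / n : ℕ) : ℝ) = f2
  generalize (((i + 1) * k / n : ℕ) : ℝ) = f1
  generalize rotationCount n k b (((i + 1 : ℕ) : ℤ) * k) = A
  rw [h2]
  generalize (∑ i ∈ Finset.range n, b ^ i) = S at *
  generalize (∑ i ∈ Finset.range n, b ^ i * ((i * k / n : ℕ) : ℝ)) = Y at *
  have hS' := hS.ne'
  rw [← sub_eq_zero]
  have : ∀ z : ℝ, S * z = 0 → z = 0 := fun z hz => (mul_eq_zero.1 hz).resolve_left hS'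
  apply this
  field_simp
  rw [pow_succ]
  linear_combination (f1 - 1) * h4 - h3

/-- All points of a tower level lie in its tile. -/
lemma towerMap_mem_tile (h : RotationData n k b a β α) {i : ℕ} (hi : i < n) {x : ℝ}
    (hx : x ∈ Icc (0 : ℝ) 1) :
    tileLeft n k b a α ((i + 1 : ℕ) * k - n * ((i + 1) * k / n : ℕ)) ≤ towerMap n k b a α i x ∧
    towerMap n k b a α i x ≤
      tileLeft n k b a α ((i + 1 : ℕ) * k - n * ((i + 1) * k / n : ℕ) + 1) := by
  have hS := h.geom_pos
  have hb := h.b_pos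
  have hb1 := h.one_lt
  obtain ⟨h0, h2⟩ := h.mem_Icc
  obtain ⟨x0, x1⟩ := hx
  have e1 : tileLeft n k b a α ((i + 1 : ℕ) * k - n * ((i + 1) * k / n : ℕ)) =
      tileLeft n k b a α ((i + 1 : ℕ) * k) - ((i + 1) * k / n : ℕ) := by
    rw [sub_eq_add_neg, ← mul_neg, h.tileLeft_add_period, Int.cast_neg, Int.cast_natCast]; ring
  have e2 : tileLeft n k b a α ((i + 1 : ℕ) * k - n * ((i + 1) * k / n : ℕ) + 1) =
      tileLeft n k b a α ((i + 1 : ℕ) * k + 1) - ((i + 1) * k / n : ℕ) := by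
    rw [sub_add_eq_add_sub, sub_eq_add_neg, ← mul_neg, h.tileLeft_add_period, Int.cast_neg, Int.cast_natCast]; ring
  rw [e1, e2]
  unfold towerMap
  constructor
  · have : 0 ≤ b ^ i * ((b - 1) * x + α / ∑ i ∈ Finset.range n, b ^ i) := by
      have : 0 ≤ (b - 1) * x := mul_nonneg (by linarith) x0
      positivity
    linarith
  · have hj := le_rotationCount_succ_sub (k := k) hb hi 0
    simp only [mul_zero, add_zero] at hj
    have e3 : tileLeft n k b a α ((i + 1 : ℕ) * k + 1) - tileLeft n k b a α ((i + 1 : ℕ) * k) =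
        (rotationCount n k b ((i + 1 : ℕ) * k + 1) - rotationCount n k b ((i + 1 : ℕ) * k)) /
          ∑ i ∈ Finset.range n, b ^ i := by
      unfold tileLeft; ring
    have h4 := h.geom_mul
    -- In units of `b ^ i / S` the level is `[α, α + β - 1]` inside the tile `[0,1]`, because `(b-1)
    -- S = β - 1`; it fits since `α ≤ 2 - β`.
    have hle : b ^ i * ((b - 1) * x + α / ∑ i ∈ Finset.range n, b ^ i) ≤
        b ^ i / ∑ i ∈ Finset.range n, b ^ i := by
      rw [div_eq_mul_one_div (b ^ i)]
      refine mul_le_mul_of_nonneg_left ?_ (by positivity)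
      rw [← sub_nonneg, show 1 / (∑ i ∈ Finset.range n, b ^ i) - ((b - 1) * x +
        α / ∑ i ∈ Finset.range n, b ^ i) = (1 - α - ((b - 1) * ∑ i ∈ Finset.range n, b ^ i) * x) /
          ∑ i ∈ Finset.range n, b ^ i by field_simp; ring, h4]
      refine div_nonneg ?_ hS.le
      nlinarith [h.beta_gt]
    have : b ^ i / (∑ i ∈ Finset.range n, b ^ i) ≤
        tileLeft n k b a α ((i + 1 : ℕ) * k + 1) - tileLeft n k b a α ((i + 1 : ℕ) * k) := by
      rw [e3]; gcongr
    linarith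

lemma two_le (h : RotationData n k b a β α) : 2 ≤ n := by
  have := h.one_le; have := h.lt; omega

lemma towerMap_last (h : RotationData n k b a β α) (x : ℝ) :
    towerMap n k b a α (n - 1) x = b * towerMap n k b a α (n - 2) x + a - 1 := by
  have hn := h.two_le
  have e := h.towerMap_succ (i := n - 2) (by omega) x
  rw [show n - 2 + 1 = n - 1 by omega, show n - 2 + 2 = n by omega, h.pred_mul_div,
    Nat.mul_div_cancel_left _ h.n_pos, Nat.cast_sub h.one_le] at e
  rw [e]; push_cast; ring

/-- The right branch of `T_β`, transported to level `0`. The left branch comes from the translate of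
level `n - 1` by `1`, treated in `iterate_return`. -/
lemma towerMap_return (h : RotationData n k b a β α) (x : ℝ) :
    b * towerMap n k b a α (n - 1) x + a = (b - 1) * (β * x + α - 1) + a := by
  have hn := h.n_pos
  have hS := h.geom_pos
  have h4 := h.geom_mul
  have h5 := h.tileLeft_zero
  have hpow : b * b ^ (n - 1) = β := by rw [← pow_succ', Nat.sub_add_cancel hn, h.pow_eq]
  unfold towerMap
  rw [Nat.sub_add_cancel hn, Nat.mul_div_cancel_left _ hn,
    show ((n : ℤ) * k) = 0 + n * (k : ℤ) by ring, h.tileLeft_add_period]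
  rw [← sub_eq_zero]
  have : ∀ z : ℝ, (∑ i ∈ Finset.range n, b ^ i) * z = 0 → z = 0 :=
    fun z hz => (mul_eq_zero.1 hz).resolve_left hS.ne'
  apply this
  push_cast
  generalize (∑ i ∈ Finset.range n, b ^ i) = S at *
  have e : S * (b * (tileLeft n k b a α 0 + k - k + b ^ (n - 1) * ((b - 1) * x + α / S)) + a -
      ((b - 1) * (β * x + α - 1) + a)) = b * S * tileLeft n k b a α 0 +
      (b * b ^ (n - 1)) * ((b - 1) * S * x + α) - ((b - 1) * S) * (β * x + α - 1) := by
    field_simp; ring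
  rw [e, hpow, h4, h5]; ring

lemma towerMap_discontinuity (h : RotationData n k b a β α) :
    towerMap n k b a α (n - 2) ((1 - α) / β) = (1 - a) / b := by
  have hb := h.b_pos
  have hβ : 0 < β := by linarith [h.beta_gt]
  have h1 := h.towerMap_return ((1 - α) / β)
  rw [h.towerMap_last, show β * ((1 - α) / β) = 1 - α by field_simp] at h1
  rw [eq_div_iff hb.ne']
  have : b * (b * towerMap n k b a α (n - 2) ((1 - α) / β) + a - 1) = 0 := by linarith
  rcases mul_eq_zero.1 this with h' | h'
  · exact absurd h' hb.ne'
  · linarith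

lemma discontinuity_mem_Ioo (h : RotationData n k b a β α) : (1 - α) / β ∈ Ioo (0 : ℝ) 1 := by
  have hβ := h.beta_gt
  obtain ⟨h0, h2⟩ := h.mem_Icc
  constructor
  · apply div_pos <;> linarith
  · rw [div_lt_one (by linarith)]; linarith

lemma towerMap_strictMono (h : RotationData n k b a β α) (i : ℕ) :
    StrictMono (towerMap n k b a α i) := by
  intro x y hxy
  have hb := h.b_pos
  rw [← sub_pos, towerMap_sub]
  exact mul_pos (mul_pos (pow_pos hb _) (by linarith [h.one_lt])) (by linarith)

/-- Level `n - 2` sits in tile `n - k`, which therefore contains the discontinuity; every other tile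
lies on one side of it. -/
lemma tile_critical (h : RotationData n k b a β α) :
    ((n - 2 + 1 : ℕ) * k - n * ((n - 2 + 1) * k / n : ℕ) : ℤ) = n - k := by
  have hn := h.two_le
  rw [show n - 2 + 1 = n - 1 by omega, h.pred_mul_div, Nat.cast_sub h.one_le,
    Nat.cast_sub h.n_pos]
  push_cast; ring

lemma tileLeft_lt_discontinuity (h : RotationData n k b a β α) :
    tileLeft n k b a α (n - k) < (1 - a) / b := by
  have hn := h.two_le
  have h1 := (h.towerMap_mem_tile (i := n - 2) (by omega) (x := 0) (by simp)).1
  rw [h.tile_critical] at h1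
  refine h1.trans_lt ?_
  rw [← h.towerMap_discontinuity]
  exact h.towerMap_strictMono _ h.discontinuity_mem_Ioo.1

lemma discontinuity_lt_tileLeft (h : RotationData n k b a β α) :
    (1 - a) / b < tileLeft n k b a α (n - k + 1) := by
  have hn := h.two_le
  have h1 := (h.towerMap_mem_tile (i := n - 2) (by omega) (x := 1) (by simp)).2
  rw [h.tile_critical] at h1
  refine lt_of_lt_of_le ?_ h1
  rw [← h.towerMap_discontinuity]
  exact h.towerMap_strictMono _ h.discontinuity_mem_Ioo.2

/-- A level below the critical one lies on one side of the discontinuity. -/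
lemma towerMap_noncritical (h : RotationData n k b a β α) {i : ℕ} (hi : i + 2 < n) :
    (∀ x ∈ Icc (0 : ℝ) 1, towerMap n k b a α i x < (1 - a) / b ∧
      towerMap n k b a α (i + 1) x = b * towerMap n k b a α i x + a) ∨
    (∀ x ∈ Icc (0 : ℝ) 1, (1 - a) / b < towerMap n k b a α i x ∧
      towerMap n k b a α (i + 1) x = b * towerMap n k b a α i x + a - 1) := by
  have hn := h.n_pos
  have hle : (i + 1) * k / n ≤ (i + 2) * k / n := Nat.div_le_div_right (by nlinarith)
  have hle' := h.div_lt_div_succ (i + 1)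
  rw [show i + 1 + 1 = i + 2 by ring] at hle'
  have hlt : (i + 2) * k < ((i + 2) * k / n + 1) * n := 
    Nat.lt_div_succ_mul hn _
  have hnd : ¬ n ∣ (i + 2) * k := by
    intro hd
    have := (Nat.Coprime.dvd_of_dvd_mul_right h.coprime hd)
    exact absurd (Nat.le_of_dvd (by omega) this) (by omega)
  have hgt : (i + 2) * k / n * n < (i + 2) * k :=
    lt_of_le_of_ne (Nat.div_mul_le_self _ _) fun he => hnd ⟨_, by rw [mul_comm n, he]⟩
  -- The floor jumps exactly when the residue of `(i+1) k` exceeds `n - k`, that is, when the tile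
  -- lies to the right of the critical one.
  rcases Nat.lt_or_ge ((i + 1) * k / n) ((i + 2) * k / n) with hd | hd
  · right
    have heq : (i + 2) * k / n = (i + 1) * k / n + 1 := by omega
    intro x hx
    constructor
    · refine h.discontinuity_lt_tileLeft.trans_le
        (le_trans (h.tileLeft_mono ?_) (h.towerMap_mem_tile (by omega) hx).1)
      rw [heq] at hgt
      zify at hgt
      push_cast
      linarith
    · rw [h.towerMap_succ (by omega), heq]; push_cast; ring
  · left
    have heq : (i + 2) * k / n = (i + 1) * k / n := by omega
    intro x hx
    constructor
    · refine lt_of_le_of_lt (le_trans (h.towerMap_mem_tile (by omega) hx).2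
        (h.tileLeft_mono ?_)) h.tileLeft_lt_discontinuity
      rw [heq] at hlt
      zify at hlt
      push_cast
      linarith
    · rw [h.towerMap_succ (by omega), heq]; ring

lemma towerMap_last_lt (h : RotationData n k b a β α) {x : ℝ} (hx : x ∈ Icc (0 : ℝ) 1) :
    towerMap n k b a α (n - 1) x < (1 - a) / b := by
  have hn := h.n_pos
  have hk := h.lt
  refine lt_of_le_of_lt (le_trans (h.towerMap_mem_tile (by omega) hx).2
    (h.tileLeft_mono ?_)) h.tileLeft_lt_discontinuity
  rw [Nat.sub_add_cancel hn, Nat.mul_div_cancel_left _ hn]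
  omega

lemma lt_towerMap_last_add_one (h : RotationData n k b a β α) {x : ℝ}
    (hx : x ∈ Icc (0 : ℝ) 1) : (1 - a) / b < towerMap n k b a α (n - 1) x + 1 := by
  have hn := h.n_pos
  have hk := h.one_le
  have h1 := (h.towerMap_mem_tile (i := n - 1) (by omega) hx).1
  rw [Nat.sub_add_cancel hn, Nat.mul_div_cancel_left _ hn, sub_self] at h1
  have h2 := h.tileLeft_add_period 0 1
  have h3 : tileLeft n k b a α (n - k + 1) ≤ tileLeft n k b a α (0 + n * 1) :=
    h.tileLeft_mono (by omega)
  have := h.discontinuity_lt_tileLeft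
  push_cast at h2
  linarith

end RotationData

end

/-! ### The sum `W` and the renormalised parameter. -/

section
variable {n k : ℕ} {b a β α : ℝ}

/-- The powers of `b` occurring in `lorenzSum` are those at the jumps of `i ↦ ⌊i k / n⌋`. -/
lemma sum_pow_div_eq_sum_jumps (hk : 1 ≤ k) (hkn : k < n) (hcop : Nat.gcd n k = 1) (b : ℝ) :
    ∑ u ∈ Finset.range k, b ^ (u * n / k) = 1 + ∑ i ∈ Finset.range (n - 1),
      b ^ i * ((((i + 1) * k / n : ℕ) : ℝ) - ((i * k / n : ℕ) : ℝ)) := by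
  have hn : 0 < n := by omega
  have hnd : ∀ i, 0 < i → i < n → ∀ t, t * n ≠ i * k := by
    intro i hi hin t he
    have := Nat.Coprime.dvd_of_dvd_mul_right hcop (Dvd.intro_left t he)
    exact absurd (Nat.le_of_dvd hi this) (by omega)
  rw [Finset.range_eq_Ico, Finset.sum_eq_sum_Ico_succ_bot hk]
  simp only [zero_mul, Nat.zero_div, pow_zero, zero_add]
  congr 1
  have hmap : ∀ t ∈ Finset.Ico 1 k, t * n / k ∈ Finset.range (n - 1) := by
    intro t ht
    rw [Finset.mem_Ico] at ht
    rw [Finset.mem_range, Nat.div_lt_iff_lt_mul hk]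
    obtain ⟨K, rfl⟩ : ∃ K, k = K + 1 := ⟨k - 1, by omega⟩
    obtain ⟨N, rfl⟩ : ∃ N, n = N + 1 := ⟨n - 1, by omega⟩
    have : t ≤ K := by omega
    simp only [Nat.add_sub_cancel]
    nlinarith
  rw [← Finset.sum_fiberwise_of_maps_to hmap]
  refine Finset.sum_congr rfl fun i hi => ?_
  rw [Finset.mem_range] at hi
  -- The fibre over `i` consists of the `t` with `i k < t n ≤ (i+1) k`; coprimality excludes
  -- equality with a multiple of `k` strictly inside the range.
  have hfil : Finset.filter (fun t => t * n / k = i) (Finset.Ico 1 k) =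
      Finset.Ioc (i * k / n) ((i + 1) * k / n) := by
    ext t
    rw [Finset.mem_filter, Finset.mem_Ico, Finset.mem_Ioc, Nat.div_lt_iff_lt_mul hn,
      Nat.le_div_iff_mul_le hn]
    constructor
    · rintro ⟨⟨ht1, ht2⟩, he⟩
      have e1 := Nat.div_mul_le_self (t * n) k
      have e2 := Nat.lt_div_succ_mul hk (t * n)
      rw [he] at e1 e2
      refine ⟨lt_of_le_of_ne e1 fun h => ?_, e2.le⟩
      rcases Nat.eq_zero_or_pos i with h0 | h0
      · subst h0
        have : 0 < t * n := Nat.mul_pos ht1 hn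
        omega
      · exact hnd i h0 (by omega) t h.symm
    · rintro ⟨e1, e2⟩
      have e3 : t * n < (i + 1) * k := lt_of_le_of_ne e2 (hnd (i + 1) (by omega) (by omega) t)
      refine ⟨⟨?_, ?_⟩, Nat.div_eq_of_lt_le e1.le e3⟩
      · rcases Nat.eq_zero_or_pos t with h0 | h0
        · subst h0; omega
        · exact h0
      · by_contra hc
        have : (i + 1) * k < n * k := Nat.mul_lt_mul_of_pos_right (by omega) hk
        nlinarith
  have hle : i * k / n ≤ (i + 1) * k / n := Nat.div_le_div_right (by nlinarith)
  rw [Finset.sum_congr rfl fun t ht => by rw [(Finset.mem_filter.1 ht).2], Finset.sum_const, hfil,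
    Nat.card_Ioc, nsmul_eq_mul, Nat.cast_sub hle, mul_comm]

/-- Put `v = V_{j-1} + i`, which runs over `1, ..., k`. The block condition `V_{j-1} < v ≤ V_j` says
`j = ⌈v s / k⌉`, so the exponent `(k - v) m + s - j` equals `⌊(k - v) n / k⌋`. -/
lemma lorenzSum_eq (hk : 2 ≤ k) (hcop : Nat.gcd n k = 1) (b : ℝ) :
    lorenzSum n k b = ∑ u ∈ Finset.range k, b ^ (u * n / k) := by
  have hs : 0 < n % k := by
    rcases Nat.eq_zero_or_pos (n % k) with h | h
    · have : k ∣ Nat.gcd n k := Nat.dvd_gcd (Nat.dvd_of_mod_eq_zero h) dvd_rfl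
      rw [hcop, Nat.dvd_one] at this
      omega
    · exact h
  have hdm : n = n / k * k + n % k := by rw [Nat.div_add_mod']
  generalize hm : n / k = m at hdm
  have hVs : lorenzV n k (n % k) = k := Nat.mul_div_cancel_left _ hs
  have hVmono : ∀ j, lorenzV n k j ≤ lorenzV n k (j + 1) :=
    fun j => Nat.div_le_div_right (by nlinarith)
  have hW : ∀ j, j + 1 ≤ n % k → lorenzW n k b (j + 1) =
      ∑ v ∈ Finset.Ioc (lorenzV n k j) (lorenzV n k (j + 1)), b ^ ((k - v) * n / k) := by
    intro j hj
    unfold lorenzW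
    rw [Nat.add_sub_cancel, hVs, hm]
    refine Finset.sum_bij' (fun i _ => lorenzV n k j + i) (fun v _ => v - lorenzV n k j)
      ?_ ?_ ?_ ?_ ?_
    · intro i hi; rw [Finset.mem_Icc] at hi; rw [Finset.mem_Ioc]; omega
    · intro v hv; rw [Finset.mem_Ioc] at hv; rw [Finset.mem_Icc]; omega
    · intro i hi; simp
    · intro v hv; rw [Finset.mem_Ioc] at hv; omega
    · intro i hi
      rw [Finset.mem_Icc] at hi
      obtain ⟨hi1, hi2⟩ := hi
      rw [Nat.sub_sub k]
      have hv2 : lorenzV n k j + i ≤ lorenzV n k (j + 1) := by omega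
      have hv1 : lorenzV n k j < lorenzV n k j + i := by omega
      generalize lorenzV n k j + i = v at *
      rw [lorenzV, Nat.le_div_iff_mul_le hs] at hv2
      rw [lorenzV, Nat.div_lt_iff_lt_mul hs] at hv1
      have hvk : v ≤ k := by
        by_contra hvk
        nlinarith
      congr 1
      generalize n % k = s at *
      obtain ⟨u, rfl⟩ : ∃ u, k = u + v := ⟨k - v, by omega⟩
      obtain ⟨r, rfl⟩ : ∃ r, s = r + (j + 1) := ⟨s - (j + 1), by omega⟩
      rw [Nat.add_sub_cancel, ← Nat.add_assoc, ← Nat.add_assoc, Nat.add_assoc (u * m + r),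
        Nat.add_sub_cancel]
      symm
      apply Nat.div_eq_of_lt_le
      · rw [hdm]; nlinarith
      · rw [hdm]; nlinarith
  have hsum : ∀ J, J ≤ n % k → ∑ j ∈ Finset.Icc 1 J, lorenzW n k b j =
      ∑ v ∈ Finset.Ioc 0 (lorenzV n k J), b ^ ((k - v) * n / k) := by
    intro J
    induction J with
    | zero => intro _; simp [lorenzV]
    | succ J ih =>
      intro hJ
      rw [Finset.sum_Icc_succ_top (by omega), ih (by omega), hW J hJ,
        Finset.sum_Ioc_consecutive _ (Nat.zero_le _) (hVmono J)]
  rw [lorenzSum, hsum _ le_rfl, hVs]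
  refine Finset.sum_bij' (fun v _ => k - v) (fun u _ => k - u) ?_ ?_ ?_ ?_ ?_
  · intro v hv; rw [Finset.mem_Ioc] at hv; rw [Finset.mem_range]; omega
  · intro u hu; rw [Finset.mem_range] at hu; rw [Finset.mem_Ioc]; omega
  · intro v hv; rw [Finset.mem_Ioc] at hv; omega
  · intro u hu; rw [Finset.mem_range] at hu; omega
  · intro v _; rfl

/-- The sum `W`, with the convention for `k = 1`. -/
lemma ite_lorenzSum_eq (hk : 1 ≤ k) (hcop : Nat.gcd n k = 1) (b : ℝ) :
    (if k = 1 then 1 else lorenzSum n k b) = ∑ u ∈ Finset.range k, b ^ (u * n / k) := by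
  split_ifs with h
  · subst h; simp
  · exact lorenzSum_eq (by omega) hcop b

/-- Summation by parts, with boundary values `0` of the floor at `i = 0` and `k - 1` at `i = n - 1`.
-/
lemma mul_sum_pow_div (hk : 1 ≤ k) (hkn : k < n) (hcop : Nat.gcd n k = 1) (b : ℝ) :
    b * ∑ u ∈ Finset.range k, b ^ (u * n / k) =
      b + (∑ i ∈ Finset.range n, b ^ i * ((i * k / n : ℕ) : ℝ)) * (1 - b) +
        b ^ n * ((k : ℝ) - 1) := by
  rw [sum_pow_div_eq_sum_jumps hk hkn hcop]
  obtain ⟨N, rfl⟩ : ∃ N, n = N + 1 := ⟨n - 1, by omega⟩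
  have hlast : N * k / (N + 1) = k - 1 := by
    obtain ⟨K, rfl⟩ : ∃ K, k = K + 1 := ⟨k - 1, by omega⟩
    simp only [Nat.add_sub_cancel]
    apply Nat.div_eq_of_lt_le <;> nlinarith
  have h1 : ∑ i ∈ Finset.range (N + 1), b ^ i * ((i * k / (N + 1) : ℕ) : ℝ) =
      b * ∑ i ∈ Finset.range N, b ^ i * (((i + 1) * k / (N + 1) : ℕ) : ℝ) := by
    rw [Finset.sum_range_succ', Finset.mul_sum]
    simp only [zero_mul, Nat.zero_div, Nat.cast_zero, mul_zero, add_zero]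
    exact Finset.sum_congr rfl fun i _ => by rw [pow_succ]; ring
  have h2 : ∑ i ∈ Finset.range (N + 1), b ^ i * ((i * k / (N + 1) : ℕ) : ℝ) =
      ∑ i ∈ Finset.range N, b ^ i * ((i * k / (N + 1) : ℕ) : ℝ) + b ^ N * ((k : ℝ) - 1) := by
    rw [Finset.sum_range_succ, hlast, Nat.cast_sub hk, Nat.cast_one]
  rw [Nat.add_sub_cancel]
  simp_rw [mul_sub (b ^ _)]
  rw [Finset.sum_sub_distrib, pow_succ]
  linear_combination (-1 : ℝ) * h1 + b * h2

lemma nthRoot_pow (hn : n ≠ 0) (hβ : 1 < β) : nthRoot n β ^ n = β := by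
  rw [nthRoot, one_div, Real.rpow_inv_natCast_pow (by linarith) hn]

lemma one_lt_nthRoot (hn : 0 < n) (hβ : 1 < β) : 1 < nthRoot n β :=
  Real.one_lt_rpow hβ (by positivity)

lemma nthRoot_inv (hβ : 1 < β) : nthRoot n β⁻¹ = (nthRoot n β)⁻¹ :=
  Real.inv_rpow (by linarith) _

/-- The defining equation of the renormalised parameter, without denominators. -/
lemma renormParam_eq (hk : 1 ≤ k) (hkn : k < n) (hcop : Nat.gcd n k = 1) (hβ : 1 < β) :
    renormParam n k β α * nthRoot n β * ∑ i ∈ Finset.range n, nthRoot n β ^ i =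
      nthRoot n β * (∑ u ∈ Finset.range k, nthRoot n β ^ (u * n / k)) -
        (1 - α) * (nthRoot n β - 1) := by
  have hn : 0 < n := by omega
  have hb := one_lt_nthRoot hn hβ
  have hpow := nthRoot_pow hn.ne' hβ
  have hgeom := mul_geom_sum (nthRoot n β) n
  have e : renormParam n k β α = (((1 - α) * (1 - (nthRoot n β)⁻¹) -
      ∑ u ∈ Finset.range k, nthRoot n β ^ (u * n / k)) * (1 - nthRoot n β)) / (β - 1) := by
    rw [← ite_lorenzSum_eq hk hcop, renormParam, nthRoot_inv hβ]
    split_ifs <;> rfl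
  rw [e]
  rw [hpow] at hgeom
  generalize nthRoot n β = b at *
  generalize ∑ i ∈ Finset.range n, b ^ i = S at *
  rw [← hgeom]
  have hS : S ≠ 0 := by rintro rfl; linarith
  have : b - 1 ≠ 0 := by linarith
  field_simp
  ring

lemma rotationData_renormParam (hk : 1 ≤ k) (hkn : k < n) (hcop : Nat.gcd n k = 1) (hβ : 1 < β)
    (hα : α ∈ Icc 0 (2 - β)) : RotationData n k (nthRoot n β) (renormParam n k β α) β α where
  one_le := hk
  lt := hkn
  coprime := hcop
  one_lt := one_lt_nthRoot (by omega) hβ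
  pow_eq := nthRoot_pow (by omega) hβ
  mem_Icc := hα
  param := by
    rw [renormParam_eq hk hkn hcop hβ, mul_sum_pow_div hk hkn hcop,
      nthRoot_pow (by omega) hβ]
    ring

/-- By `renormParam_eq` the parameter is affine and increasing in `α`; the two end points of the
interval are its values at `α = 0` and `α = 2 - β`. -/
lemma renormParam_mem_parameterInterval (hk : 1 ≤ k) (hkn : k < n) (hcop : Nat.gcd n k = 1)
    (hβ : 1 < β) (hα : α ∈ Icc 0 (2 - β)) :
    renormParam n k β α ∈ parameterInterval n k (nthRoot n β) := by
  have hn : 0 < n := by omega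
  have hb := one_lt_nthRoot hn hβ
  have hpow := nthRoot_pow hn.ne' hβ
  have hS := (rotationData_renormParam hk hkn hcop hβ hα).geom_pos
  have he := renormParam_eq (α := α) hk hkn hcop hβ
  rw [← ite_lorenzSum_eq hk hcop] at he
  obtain ⟨h0, h2⟩ := hα
  unfold parameterInterval
  generalize nthRoot n β = b at *
  have hbS : 0 < b * ∑ i ∈ Finset.range n, b ^ i := by positivity
  split_ifs at he ⊢
  · rw [mem_Icc, div_le_iff₀ hbS, le_div_iff₀ hbS, ← mul_assoc, he, pow_succ, hpow]
    constructor <;> nlinarith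
  · rw [mem_Icc, div_le_iff₀ hbS, le_div_iff₀ hbS, ← mul_assoc, he, pow_succ, hpow]
    constructor <;> nlinarith

namespace RotationData

/-- The point `0` lies in tile `0`, since level `n - 1` passes through it at the cut. Level `0` is
`[a, a + b - 1]` and lies in tile `k`, between tile `0` and its translate by `1`; so `0 ≤ a` and `a
+ b - 1 ≤ 1`. -/
lemma param_mem_Icc (h : RotationData n k b a β α) : a ∈ Icc 0 (2 - b) := by
  have hn := h.two_le
  have hk := h.one_le
  have hkn := h.lt
  have hp := h.discontinuity_mem_Ioo
  have hb := h.b_pos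
  have hz : towerMap n k b a α (n - 1) ((1 - α) / β) = 0 := by
    rw [h.towerMap_last, h.towerMap_discontinuity]; field_simp; ring
  have ht := h.towerMap_mem_tile (i := n - 1) (by omega) ⟨hp.1.le, hp.2.le⟩
  rw [Nat.sub_add_cancel h.n_pos, Nat.mul_div_cancel_left _ h.n_pos, sub_self, hz] at ht
  have h0 := (h.towerMap_mem_tile (i := 0) h.n_pos (x := 0) (by simp)).1
  have h1 := (h.towerMap_mem_tile (i := 0) h.n_pos (x := 1) (by simp)).2
  have hd : (0 + 1) * k / n = 0 := by rw [zero_add, one_mul]; exact Nat.div_eq_of_lt hkn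
  rw [h.towerMap_zero, hd] at h0 h1
  have m0 : tileLeft n k b a α (0 + 1) ≤
      tileLeft n k b a α ((0 + 1 : ℕ) * k - n * (0 : ℕ)) :=
    h.tileLeft_mono (by push_cast; omega)
  have m1 : tileLeft n k b a α ((0 + 1 : ℕ) * k - n * (0 : ℕ) + 1) ≤
      tileLeft n k b a α (0 + n * 1) :=
    h.tileLeft_mono (by push_cast; omega)
  rw [h.tileLeft_add_period] at m1
  push_cast at *
  constructor <;> linarith

end RotationData

end

/-! ### Finite orbits and the field generated by a Pisot number. -/

section Pisot

variable {β α : ℝ} {T : ℝ → ℝ}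

/-- Each iterate has the form `β ^ j * y` plus an element of the field, so two coinciding iterates
determine `y` by a linear equation with nonzero leading coefficient `β ^ j - β ^ i`. -/
lemma mem_fieldQ_of_finite_orbit (hβ : 1 < β) (hαQ : α ∈ fieldQ β)
    (hT : ∀ x, T x = β * x + α ∨ T x = β * x + α - 1) {y : ℝ}
    (hy : (range fun j : ℕ => T^[j] y).Finite) : y ∈ fieldQ β := by
  set K := IntermediateField.adjoin ℚ ({β} : Set ℝ) with hK
  have hβK : β ∈ K := IntermediateField.mem_adjoin_simple_self ℚ β
  have hαK : α ∈ K := hαQ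
  have hform : ∀ j : ℕ, T^[j] y - β ^ j * y ∈ K := by
    intro j
    induction j with
    | zero => simp [zero_mem]
    | succ j ih =>
      rw [Function.iterate_succ_apply']
      rcases hT (T^[j] y) with h | h
      · rw [h, show β * T^[j] y + α - β ^ (j + 1) * y = β * (T^[j] y - β ^ j * y) + α by ring]
        exact add_mem (mul_mem hβK ih) hαK
      · rw [h, show β * T^[j] y + α - 1 - β ^ (j + 1) * y =
          β * (T^[j] y - β ^ j * y) + α - 1 by ring]
        exact sub_mem (add_mem (mul_mem hβK ih) hαK) (one_mem _)
  have hninj : ¬ Function.Injective fun j : ℕ => T^[j] y := fun hinj =>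
    infinite_range_of_injective hinj hy
  obtain ⟨i, j, hij, hne⟩ : ∃ i j : ℕ, T^[i] y = T^[j] y ∧ i ≠ j := by
    simpa [Function.Injective, and_comm] using hninj
  have hpow : β ^ j - β ^ i ≠ 0 := by
    rw [sub_ne_zero]
    exact fun he => hne (pow_right_injective₀ (by linarith) hβ.ne' he).symm
  have hyeq : y = ((T^[i] y - β ^ i * y) - (T^[j] y - β ^ j * y)) / (β ^ j - β ^ i) := by
    rw [hij]; field_simp; ring
  change y ∈ K
  rw [hyeq]
  exact div_mem (sub_mem (hform i) (hform j)) (sub_mem (pow_mem hβK _) (pow_mem hβK _))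

/-- Points of `ℚ(β)` have finite orbits when `β` is a Pisot number. -/
lemma finite_orbit_of_mem_fieldQ (hβ : IsPisot β) (hαQ : α ∈ fieldQ β)
    (hT : ∀ x, T x = β * x + α ∨ T x = β * x + α - 1)
    (hTI : ∀ x ∈ Icc (0 : ℝ) 1, T x ∈ Icc (0 : ℝ) 1) {y : ℝ} (hyQ : y ∈ fieldQ β)
    (hy : y ∈ Icc (0 : ℝ) 1) : (range fun j : ℕ => T^[j] y).Finite := by
  obtain ⟨hβ1, hβint, hconj⟩ := hβ
  have hint : IsIntegral ℚ β := hβint.tower_top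
  set K := IntermediateField.adjoin ℚ ({β} : Set ℝ) with hK
  have : FiniteDimensional ℚ K := IntermediateField.adjoin.finiteDimensional hint
  have : NumberField K := ⟨⟩
  let B : K := ⟨β, IntermediateField.mem_adjoin_simple_self ℚ β⟩
  let A : K := ⟨α, hαQ⟩
  let Y : K := ⟨y, hyQ⟩
  have hBint : IsIntegral ℤ B := by
    have : IsIntegral ℤ ((algebraMap K ℝ) B) := hβint
    exact (isIntegral_algebraMap_iff (algebraMap K ℝ).injective).1 this
  obtain ⟨q, hq0, hqA, hqY⟩ : ∃ q : ℤ, q ≠ 0 ∧ IsIntegral ℤ ((q : K) * A) ∧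
      IsIntegral ℤ ((q : K) * Y) := by
    have halg : ∀ z : K, IsAlgebraic ℤ z := fun z =>
      (IsFractionRing.isAlgebraic_iff ℤ ℚ K).2 (Algebra.IsAlgebraic.isAlgebraic z)
    obtain ⟨q₁, h₁, i₁⟩ := (halg A).exists_integral_multiple
    obtain ⟨q₂, h₂, i₂⟩ := (halg Y).exists_integral_multiple
    rw [zsmul_eq_mul] at i₁ i₂
    refine ⟨q₂ * q₁, mul_ne_zero h₂ h₁, ?_, ?_⟩
    · rw [Int.cast_mul, mul_assoc]
      exact (isIntegral_algebraMap (R := ℤ) (A := K) (x := q₂)).mul i₁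
    · rw [Int.cast_mul, mul_comm (q₂ : K), mul_assoc]
      exact (isIntegral_algebraMap (R := ℤ) (A := K) (x := q₁)).mul i₂
  have hφβ : ∀ φ : K →+* ℂ, φ B ≠ (β : ℂ) → ‖φ B‖ < 1 := by
    intro φ hne
    refine hconj _ ?_ hne
    rw [Polynomial.mem_aroots]
    refine ⟨minpoly.ne_zero hint, ?_⟩
    have h1 : Polynomial.aeval B (minpoly ℚ β) = 0 := by
      apply (algebraMap K ℝ).injective
      rw [← Polynomial.aeval_algebraMap_apply, map_zero]
      exact minpoly.aeval ℚ β
    have h2 := congrArg φ.toRatAlgHom h1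
    rw [← Polynomial.aeval_algHom_apply, map_zero] at h2
    exact h2
  have hφid : ∀ φ : K →+* ℂ, φ B = (β : ℂ) → ∀ z : K, φ z = ((z : ℝ) : ℂ) := by
    intro φ he z
    let ψ : K →+* ℂ := Complex.ofRealHom.comp (algebraMap K ℝ)
    have : φ.toRatAlgHom = ψ.toRatAlgHom := by
      refine IntermediateField.algHom_ext_of_eq_adjoin _ hK fun x hx => ?_
      obtain rfl := mem_singleton_iff.1 hx
      exact he
    exact DFunLike.congr_fun this z
  -- Chosen so that `‖φ B‖ M + ‖φ A‖ + 1 ≤ M` when `‖φ B‖ < 1`: the disc of radius `M φ` is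
  -- preserved by both conjugated branches and contains the starting point.
  let M : (K →+* ℂ) → ℝ := fun φ => max ‖φ Y‖ ((‖φ A‖ + 1) / (1 - ‖φ B‖))
  have hM0 : ∀ φ, 0 ≤ M φ := fun φ => (norm_nonneg _).trans (le_max_left _ _)
  have horb : ∀ j : ℕ, ∃ z : K, (z : ℝ) = T^[j] y ∧ IsIntegral ℤ ((q : K) * z) ∧
      ∀ φ : K →+* ℂ, φ B ≠ (β : ℂ) → ‖φ z‖ ≤ M φ := by
    intro j
    induction j with
    | zero => exact ⟨Y, rfl, hqY, fun φ _ => le_max_left _ _⟩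
    | succ j ih =>
      obtain ⟨z, hz, hzint, hzφ⟩ := ih
      have hstep : ∀ d : ℤ, |d| ≤ 1 → IsIntegral ℤ ((q : K) * (B * z + A - d)) ∧
          ∀ φ : K →+* ℂ, φ B ≠ (β : ℂ) → ‖φ (B * z + A - d)‖ ≤ M φ := by
        intro d hd
        constructor
        · rw [show (q : K) * (B * z + A - d) = B * (q * z) + q * A - q * d by ring]
          refine ((hBint.mul hzint).add hqA).sub ?_
          exact_mod_cast isIntegral_algebraMap (R := ℤ) (A := K) (x := q * d)
        · intro φ hφ
          have hr := hφβ φ hφ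
          have hz' := hzφ φ hφ
          have hM : (‖φ A‖ + 1) ≤ M φ * (1 - ‖φ B‖) := by
            rw [← div_le_iff₀ (by linarith)]; exact le_max_right _ _
          have hd' : ‖φ (d : K)‖ ≤ 1 := by
            rw [map_intCast, Complex.norm_intCast]; exact_mod_cast hd
          calc ‖φ (B * z + A - d)‖ ≤ ‖φ B‖ * ‖φ z‖ + ‖φ A‖ + ‖φ (d : K)‖ := by
                rw [map_sub, map_add, map_mul, ← norm_mul]
                exact (norm_sub_le _ _).trans (by gcongr; exact norm_add_le _ _)
            _ ≤ ‖φ B‖ * M φ + ‖φ A‖ + 1 := by gcongr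
            _ ≤ M φ := by linarith
      rw [Function.iterate_succ_apply']
      rcases hT (T^[j] y) with h | h
      · refine ⟨B * z + A - (0 : ℤ), ?_, hstep 0 (by simp)⟩
        rw [h, ← hz]; push_cast; simp [B, A]
      · refine ⟨B * z + A - (1 : ℤ), ?_, hstep 1 (by simp)⟩
        rw [h, ← hz]; push_cast; simp [B, A]
  -- After multiplication by the common denominator `q`, the orbit consists of algebraic integers of
  -- `K` with all conjugates bounded: by `M φ` where `β` is moved, by `1` where it is fixed.
  have hfin := NumberField.Embeddings.finite_of_norm_le K ℂ (|(q : ℝ)| * (1 + ∑ φ, M φ))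
  refine (hfin.image fun z : K => (z : ℝ) / q).subset ?_
  rintro _ ⟨j, rfl⟩
  obtain ⟨z, hz, hzint, hzφ⟩ := horb j
  refine ⟨q * z, ⟨hzint, fun φ => ?_⟩, ?_⟩
  · rw [map_mul, norm_mul, map_intCast, Complex.norm_intCast]
    refine mul_le_mul_of_nonneg_left ?_ (abs_nonneg _)
    have hs : M φ ≤ ∑ φ, M φ := Finset.single_le_sum (fun φ _ => hM0 φ) (Finset.mem_univ φ)
    by_cases hφ : φ B = (β : ℂ)
    · rw [hφid φ hφ z, hz, Complex.norm_real, Real.norm_eq_abs]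
      have := iterate_mem_Icc hTI hy j
      rw [abs_of_nonneg this.1]
      linarith [this.2, hM0 φ]
    · linarith [hzφ φ hφ]
  · have : (q : ℝ) ≠ 0 := by exact_mod_cast hq0
    dsimp only
    rw [← hz]; push_cast; field_simp

end Pisot

/-! ### Positivity of the density and the support. -/

section
variable {b a : ℝ}

/-- An open set on which Parry's density is positive up to countably many points lies in the
support of Parry's measure. -/
lemma subset_support_of_parryDensity_pos (hb : 1 < b) {O C : Set ℝ} (hO : IsOpen O)
    (hC : C.Countable) (hpos : ∀ x ∈ O, x ∉ C → 0 < parryDensity b a x) :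
    O ⊆ (parryMeasureAux b a).support := by
  intro x hx
  rw [Measure.mem_support_iff_forall]
  intro U hU
  rw [pos_iff_ne_zero]
  intro h0
  have hV : IsOpen (interior U ∩ O) := isOpen_interior.inter hO
  have hVx : x ∈ interior U ∩ O := ⟨mem_interior_iff_mem_nhds.2 hU, hx⟩
  have hV0 : parryMeasureAux b a (interior U ∩ O) = 0 :=
    measure_mono_null (inter_subset_left.trans interior_subset) h0
  rw [parryMeasureAux, withDensity_apply _ hV.measurableSet,
    lintegral_eq_zero_iff (measurable_parryDensity hb).ennreal_ofReal, EventuallyEq,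
    ae_restrict_iff' hV.measurableSet] at hV0
  have hnull : volume (interior U ∩ O) = 0 := by
    refine measure_mono_null (fun y hy => ?_) (measure_union_null (ae_iff.1 hV0) (hC.measure_zero _))
    by_cases hyC : y ∈ C
    · exact Or.inr hyC
    · left
      simp only [mem_ofPred_eq, Classical.not_imp]
      exact ⟨hy, by simpa using hpos y hy.2 hyC⟩
  exact (hV.measure_pos volume ⟨x, hVx⟩).ne' hnull

lemma image_Icc_subset_support (hb : 1 < b) {f : ℝ → ℝ} (hf : Continuous f) (hmono : StrictMono f)
    {u v : ℝ} (huv : u < v) {C : Set ℝ} (hC : C.Countable)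
    (hpos : ∀ y ∈ Ioo u v, y ∉ C → 0 < parryDensity b a (f y)) :
    f '' Icc u v ⊆ (parryMeasureAux b a).support := by
  have hsub : Ioo (f u) (f v) ⊆ (parryMeasureAux b a).support := by
    refine subset_support_of_parryDensity_pos hb isOpen_Ioo (hC.image f) fun x hx hxC => ?_
    obtain ⟨y, hy, rfl⟩ := intermediate_value_Ioo huv.le hf.continuousOn hx
    exact hpos y hy fun h => hxC ⟨y, h, rfl⟩
  have hcl := closure_minimal hsub Measure.isClosed_support
  rw [closure_Ioo (hmono huv).ne] at hcl
  rintro _ ⟨y, hy, rfl⟩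
  exact hcl ⟨hmono.monotone hy.1, hmono.monotone hy.2⟩

end

/-! ### The renormalisation identity and the support of Parry's measure. -/

section
variable {n k : ℕ} {b a β α : ℝ}

/-- The union of the closed levels of the renormalisation tower. -/
def towerUnion (n k : ℕ) (b a β α : ℝ) : Set ℝ :=
  (⋃ i ∈ Finset.range (n - 1), towerMap n k b a α i '' Icc 0 1) ∪
    (towerMap n k b a α (n - 1) '' Icc ((1 - α) / β) 1 ∪
      (fun x => towerMap n k b a α (n - 1) x + 1) '' Icc 0 ((1 - α) / β))

lemma continuous_towerMap (i : ℕ) : Continuous (towerMap n k b a α i) := by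
  unfold towerMap; fun_prop

lemma isClosed_towerUnion : IsClosed (towerUnion n k b a β α) := by
  refine IsClosed.union (isClosed_biUnion_finset fun i _ => ?_) (IsClosed.union ?_ ?_)
  · exact (isCompact_Icc.image (continuous_towerMap i)).isClosed
  · exact (isCompact_Icc.image (continuous_towerMap _)).isClosed
  · exact (isCompact_Icc.image ((continuous_towerMap _).add continuous_const)).isClosed

/-- A piecewise affine map with the two branches of `Tplus β α`, with value `v` at the
discontinuity. -/
structure IsBranchMap (β α v : ℝ) (T : ℝ → ℝ) : Prop where
  left : ∀ x < (1 - α) / β, T x = β * x + α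
  right : ∀ x, (1 - α) / β < x → T x = β * x + α - 1
  at_discontinuity : T ((1 - α) / β) = v

lemma isBranchMap_Tplus (hβ : 1 < β) : IsBranchMap β α 0 (Tplus β α) where
  left _ hx := if_pos hx
  right _ hx := if_neg hx.not_gt
  at_discontinuity := by rw [Tplus, if_neg (lt_irrefl _)]; field_simp; ring

lemma isBranchMap_Tminus (hβ : 1 < β) : IsBranchMap β α 1 (Tminus β α) where
  left _ hx := if_pos hx.le
  right _ hx := if_neg hx.not_ge
  at_discontinuity := Tminus_discontinuity hβ

namespace RotationData

variable {T Tβ : ℝ → ℝ} {v : ℝ}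

lemma param_discontinuity_mem_Ioo (h : RotationData n k b a β α) :
    (1 - a) / b ∈ Ioo (0 : ℝ) 1 := by
  have hb := h.one_lt
  obtain ⟨h0, h2⟩ := h.param_mem_Icc
  constructor
  · apply div_pos <;> linarith
  · rw [div_lt_one (by linarith)]; linarith

lemma iterate_lower (h : RotationData n k b a β α) (hT : IsBranchMap b a v T) {i : ℕ}
    (hi : i + 1 < n) {x : ℝ} (hx : x ∈ Icc (0 : ℝ) 1) :
    T^[i] ((b - 1) * x + a) = towerMap n k b a α i x := by
  induction i with
  | zero => rw [h.towerMap_zero]; rfl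
  | succ i ih =>
    rw [Function.iterate_succ_apply', ih (by omega)]
    rcases h.towerMap_noncritical (i := i) (by omega) with h' | h'
    · rw [(h' x hx).2, hT.left _ (h' x hx).1]
    · rw [(h' x hx).2, hT.right _ (h' x hx).1]

lemma iterate_pred (h : RotationData n k b a β α) (hT : IsBranchMap b a v T) {x : ℝ}
    (hx : x ∈ Icc (0 : ℝ) 1) :
    T^[n - 1] ((b - 1) * x + a) = T (towerMap n k b a α (n - 2) x) := by
  have hn := h.two_le
  rw [show n - 1 = n - 2 + 1 by omega, Function.iterate_succ_apply',
    h.iterate_lower hT (by omega) hx]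

lemma iterate_pred_of_lt (h : RotationData n k b a β α) (hT : IsBranchMap b a v T) {x : ℝ}
    (hx : x ∈ Icc (0 : ℝ) 1) (hlt : x < (1 - α) / β) :
    T^[n - 1] ((b - 1) * x + a) = towerMap n k b a α (n - 1) x + 1 := by
  rw [h.iterate_pred hT hx, hT.left, h.towerMap_last]
  · ring
  · rw [← h.towerMap_discontinuity]; exact h.towerMap_strictMono _ hlt

lemma iterate_pred_of_gt (h : RotationData n k b a β α) (hT : IsBranchMap b a v T) {x : ℝ}
    (hx : x ∈ Icc (0 : ℝ) 1) (hgt : (1 - α) / β < x) :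
    T^[n - 1] ((b - 1) * x + a) = towerMap n k b a α (n - 1) x := by
  rw [h.iterate_pred hT hx, hT.right, h.towerMap_last]
  rw [← h.towerMap_discontinuity]; exact h.towerMap_strictMono _ hgt

lemma iterate_pred_discontinuity (h : RotationData n k b a β α) (hT : IsBranchMap b a v T) :
    T^[n - 1] ((b - 1) * ((1 - α) / β) + a) = v := by
  have hp := h.discontinuity_mem_Ioo
  rw [h.iterate_pred hT ⟨hp.1.le, hp.2.le⟩, h.towerMap_discontinuity, hT.at_discontinuity]

lemma towerMap_last_discontinuity (h : RotationData n k b a β α) :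
    towerMap n k b a α (n - 1) ((1 - α) / β) = 0 := by
  have hb := h.b_pos
  rw [h.towerMap_last, h.towerMap_discontinuity]; field_simp; ring

lemma branch_zero (h : RotationData n k b a β α) (hT : IsBranchMap b a v T) : T 0 = a := by
  rw [hT.left _ h.param_discontinuity_mem_Ioo.1]; ring

lemma branch_one (h : RotationData n k b a β α) (hT : IsBranchMap b a v T) :
    T 1 = (b - 1) * 1 + a := by
  rw [hT.right _ h.param_discontinuity_mem_Ioo.2]; ring

/-- The value `v` at the discontinuity is the same for `T` and `T_β`, so this makes the
renormalisation identity hold at the cut as well. -/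
lemma branch_endpoint (h : RotationData n k b a β α) (hT : IsBranchMap b a v T)
    (hv : v = 0 ∨ v = 1) : T v = (b - 1) * v + a := by
  rcases hv with rfl | rfl
  · rw [h.branch_zero hT]; ring
  · exact h.branch_one hT

/-- The renormalisation identity. -/
lemma iterate_return (h : RotationData n k b a β α) (hT : IsBranchMap b a v T)
    (hTβ : IsBranchMap β α v Tβ) (hv : v = 0 ∨ v = 1) {x : ℝ} (hx : x ∈ Icc (0 : ℝ) 1) :
    T^[n] ((b - 1) * x + a) = (b - 1) * Tβ x + a := by
  have hn := h.two_le
  have hr := h.towerMap_return x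
  rw [show T^[n] = T^[(n - 1) + 1] by rw [Nat.sub_add_cancel (by omega)],
    Function.iterate_succ_apply']
  rcases lt_trichotomy x ((1 - α) / β) with hlt | rfl | hgt
  · rw [h.iterate_pred_of_lt hT hx hlt, hT.right _ (h.lt_towerMap_last_add_one hx),
      hTβ.left _ hlt]
    linear_combination hr
  · rw [h.iterate_pred_discontinuity hT, hTβ.at_discontinuity, h.branch_endpoint hT hv]
  · rw [h.iterate_pred_of_gt hT hx hgt, hT.left _ (h.towerMap_last_lt hx), hTβ.right _ hgt, hr]

lemma iterate_mul_return (h : RotationData n k b a β α) (hT : IsBranchMap b a v T)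
    (hTβ : IsBranchMap β α v Tβ) (hv : v = 0 ∨ v = 1)
    (hTI : ∀ x ∈ Icc (0 : ℝ) 1, Tβ x ∈ Icc (0 : ℝ) 1) {x : ℝ} (hx : x ∈ Icc (0 : ℝ) 1) (q : ℕ) :
    T^[n * q] ((b - 1) * x + a) = (b - 1) * Tβ^[q] x + a := by
  induction q with
  | zero => rfl
  | succ q ih =>
    rw [Nat.mul_succ, add_comm, Function.iterate_add_apply, ih,
      h.iterate_return hT hTβ hv (iterate_mem_Icc hTI hx q), Function.iterate_succ_apply']

/-- The tower in terms of iterates. -/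
lemma towerUnion_eq (h : RotationData n k b a β α) (hT : IsBranchMap b a v T)
    (hv : v = 0 ∨ v = 1) :
    towerUnion n k b a β α =
      (⋃ i ∈ Finset.range n, T^[i] '' ((fun x => (b - 1) * x + a) '' Icc 0 1)) ∪ {1 - v} := by
  have hn := h.two_le
  have hp := h.discontinuity_mem_Ioo
  apply Subset.antisymm
  · rintro y (hy | hy | hy)
    · obtain ⟨i, hi, x, hx, rfl⟩ := mem_iUnion₂.1 hy
      rw [Finset.mem_range] at hi
      refine Or.inl (mem_iUnion₂.2 ⟨i, Finset.mem_range.2 (by omega), _, ⟨x, hx, rfl⟩, ?_⟩)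
      exact h.iterate_lower hT (by omega) hx
    · obtain ⟨x, hx, rfl⟩ := hy
      have hxI : x ∈ Icc (0 : ℝ) 1 := ⟨hp.1.le.trans hx.1, hx.2⟩
      rcases hx.1.eq_or_lt with he | hgt
      -- At the cut the closed tower has both `0` and `1`; the map attains `v`, and the other one is
      -- the extra point `1 - v`.
      · rw [← he, h.towerMap_last_discontinuity]
        rcases hv with rfl | rfl
        · refine Or.inl (mem_iUnion₂.2 ⟨n - 1, Finset.mem_range.2 (by omega), _,
            ⟨_, ⟨hp.1.le, hp.2.le⟩, rfl⟩, h.iterate_pred_discontinuity hT⟩)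
        · right; simp
      · exact Or.inl (mem_iUnion₂.2 ⟨n - 1, Finset.mem_range.2 (by omega), _,
          ⟨x, hxI, rfl⟩, h.iterate_pred_of_gt hT hxI hgt⟩)
    · obtain ⟨x, hx, rfl⟩ := hy
      have hxI : x ∈ Icc (0 : ℝ) 1 := ⟨hx.1, hx.2.trans hp.2.le⟩
      rcases hx.2.eq_or_lt with he | hlt
      · rw [he]
        dsimp only
        rw [h.towerMap_last_discontinuity, zero_add]
        rcases hv with rfl | rfl
        · right; simp
        · refine Or.inl (mem_iUnion₂.2 ⟨n - 1, Finset.mem_range.2 (by omega), _,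
            ⟨_, ⟨hp.1.le, hp.2.le⟩, rfl⟩, h.iterate_pred_discontinuity hT⟩)
      · exact Or.inl (mem_iUnion₂.2 ⟨n - 1, Finset.mem_range.2 (by omega), _,
          ⟨x, hxI, rfl⟩, h.iterate_pred_of_lt hT hxI hlt⟩)
  · have hzero : (0 : ℝ) ∈ towerUnion n k b a β α :=
      Or.inr (Or.inl ⟨_, ⟨le_rfl, hp.2.le⟩, h.towerMap_last_discontinuity⟩)
    have hone : (1 : ℝ) ∈ towerUnion n k b a β α :=
      Or.inr (Or.inr ⟨_, ⟨hp.1.le, le_rfl⟩, by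
        dsimp only; rw [h.towerMap_last_discontinuity, zero_add]⟩)
    rintro y (hy | hy)
    · obtain ⟨i, hi, _, ⟨x, hx, rfl⟩, rfl⟩ := mem_iUnion₂.1 hy
      rw [Finset.mem_range] at hi
      dsimp only
      by_cases hin : i + 1 < n
      · rw [h.iterate_lower hT hin hx]
        exact Or.inl (mem_iUnion₂.2 ⟨i, Finset.mem_range.2 (by omega), x, hx, rfl⟩)
      · obtain rfl : i = n - 1 := by omega
        rcases lt_trichotomy x ((1 - α) / β) with hlt | rfl | hgt
        · rw [h.iterate_pred_of_lt hT hx hlt]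
          exact Or.inr (Or.inr ⟨x, ⟨hx.1, hlt.le⟩, rfl⟩)
        · rw [h.iterate_pred_discontinuity hT]
          rcases hv with rfl | rfl
          exacts [hzero, hone]
        · rw [h.iterate_pred_of_gt hT hx hgt]
          exact Or.inr (Or.inl ⟨x, ⟨hgt.le, hx.2⟩, rfl⟩)
    · rw [mem_singleton_iff.1 hy]
      rcases hv with rfl | rfl
      · simpa using hone
      · simpa using hzero

/-- Parry's density vanishes off the tower. -/
lemma parryDensity_eq_zero_off_tower (h : RotationData n k b a β α) {x : ℝ}
    (hx : x ∉ towerUnion n k b a β α) : parryDensity b a x = 0 := by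
  by_cases hxI : x ∈ Ico (0 : ℝ) 1
  swap
  · exact parryDensity_eq_zero h.one_lt h.param_mem_Icc hxI
  have hn := h.two_le
  have hp := h.discontinuity_mem_Ioo
  have hT := isBranchMap_Tplus (α := a) h.one_lt
  have hTβ := isBranchMap_Tplus (α := α) h.beta_gt
  have hTI : ∀ y ∈ Icc (0 : ℝ) 1, Tplus β α y ∈ Icc (0 : ℝ) 1 :=
    fun y => Tplus_mem_Icc h.beta_gt h.mem_Icc
  -- The two pieces of level `n - 1` abut `0` and `1`, so a point of `[0,1)` off the tower lies
  -- strictly between them.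
  have hgap1 : towerMap n k b a α (n - 1) 1 < x := by
    by_contra hc
    have hmem : x ∈ Icc (towerMap n k b a α (n - 1) ((1 - α) / β))
        (towerMap n k b a α (n - 1) 1) := ⟨by rw [h.towerMap_last_discontinuity]; exact hxI.1,
          not_lt.1 hc⟩
    exact hx (Or.inr (Or.inl
      (intermediate_value_Icc hp.2.le (continuous_towerMap _).continuousOn hmem)))
  have hgap0 : x < towerMap n k b a α (n - 1) 0 + 1 := by
    by_contra hc
    have hmem : x ∈ Icc (towerMap n k b a α (n - 1) 0 + 1)
        (towerMap n k b a α (n - 1) ((1 - α) / β) + 1) := ⟨not_lt.1 hc, by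
          rw [h.towerMap_last_discontinuity]; linarith [hxI.2]⟩
    exact hx (Or.inr (Or.inr (intermediate_value_Icc (f := fun y =>
      towerMap n k b a α (n - 1) y + 1) hp.1.le
      ((continuous_towerMap _).add continuous_const).continuousOn hmem)))
  have horb : ∀ z ∈ Icc (0 : ℝ) 1, Tplus b a z = (b - 1) * z + a → ∀ q i,
      (Tplus b a)^[n * q + i + 1] z =
        (Tplus b a)^[i] ((b - 1) * (Tplus β α)^[q] z + a) := by
    intro z hz hzT q i
    rw [Function.iterate_succ_apply, hzT, add_comm (n * q), Function.iterate_add_apply,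
      h.iterate_mul_return hT hTβ (Or.inl rfl) hTI hz]
  have horb1 := horb 1 (by simp) (h.branch_one hT)
  have horb0 := horb 0 (by simp) (by rw [h.branch_zero hT]; ring)
  have hI1 : ∀ q, (Tplus β α)^[q] 1 ∈ Icc (0 : ℝ) 1 := iterate_mem_Icc hTI (by simp)
  have hI0 : ∀ q, (Tplus β α)^[q] 0 ∈ Icc (0 : ℝ) 1 := iterate_mem_Icc hTI (by simp)
  -- At these times both orbits are in level `i`, an interval not containing `x`, so the two
  -- indicators agree.
  have hlow : ∀ q i, i + 1 < n → parryTerm b a (n * q + i + 1) x = 0 := by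
    intro q i hi
    unfold parryTerm
    rw [horb1, horb0, h.iterate_lower hT hi (hI1 q), h.iterate_lower hT hi (hI0 q)]
    have hmono := (h.towerMap_strictMono i).monotone
    have hout : x < towerMap n k b a α i 0 ∨ towerMap n k b a α i 1 < x := by
      by_contra hc
      rw [not_or, not_lt, not_lt] at hc
      exact hx (Or.inl (mem_iUnion₂.2 ⟨i, Finset.mem_range.2 (by omega),
        intermediate_value_Icc zero_le_one (continuous_towerMap _).continuousOn hc⟩))
    rcases hout with hc | hc
    · rw [indicator_of_mem (show x ∈ Ico 0 _ from ⟨hxI.1, hc.trans_le (hmono (hI1 q).1)⟩),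
        indicator_of_mem (show x ∈ Ico 0 _ from ⟨hxI.1, hc.trans_le (hmono (hI0 q).1)⟩)]
      simp
    · rw [indicator_of_notMem (show x ∉ Ico 0 _ from
          fun hm => absurd (hm.2.trans_le (hmono (hI1 q).2)) hc.not_gt),
        indicator_of_notMem (show x ∉ Ico 0 _ from
          fun hm => absurd (hm.2.trans_le (hmono (hI0 q).2)) hc.not_gt)]
      simp
  -- At level `n - 1` a parameter left of the cut gives a point above `x`, any other a point below,
  -- so the indicator reads off the digit of `T_β`.
  have hind : ∀ y ∈ Icc (0 : ℝ) 1, (Ico 0 ((Tplus b a)^[n - 1] ((b - 1) * y + a))).indicator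
      (fun _ => (1 : ℝ)) x = 1 - betaDigit β α y := by
    intro y hy
    have hmono := (h.towerMap_strictMono (n - 1)).monotone
    unfold betaDigit
    split_ifs with hlt
    · rw [h.iterate_pred_of_lt hT hy hlt,
        indicator_of_mem (show x ∈ Ico 0 _ from ⟨hxI.1, by linarith [hmono hy.1]⟩), sub_zero]
    · have hval : (Tplus b a)^[n - 1] ((b - 1) * y + a) = towerMap n k b a α (n - 1) y := by
        rcases (not_lt.1 hlt).eq_or_lt with he | hgt
        · rw [← he, h.iterate_pred_discontinuity hT, h.towerMap_last_discontinuity]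
        · exact h.iterate_pred_of_gt hT hy hgt
      rw [hval, indicator_of_notMem (show x ∉ Ico 0 _ from
        fun hm => by linarith [hmono hy.2, hm.2]), sub_self]
  have hcrit : ∀ q, parryTerm b a (n * (q + 1)) x = -((β ^ (q + 1))⁻¹ *
      (betaDigit β α ((Tplus β α)^[q] 1) - betaDigit β α ((Tplus β α)^[q] 0))) := by
    intro q
    unfold parryTerm
    rw [pow_mul, h.pow_eq, show n * (q + 1) = n * q + (n - 1) + 1 by rw [Nat.mul_succ]; omega,
      horb1, horb0, hind _ (hI1 q), hind _ (hI0 q)]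
    ring
  have hzero : parryTerm b a (n * 0) x = 1 := by
    simp [parryTerm, hxI.1, hxI.2]
  -- The initial term `1` cancels the digit series of `T_β`, which sums to `1`.
  have hsum : HasSum (fun q => parryTerm b a (n * q) x) 0 := by
    rw [← hasSum_nat_add_iff' 1]
    simp only [Finset.sum_range_one, hzero, hcrit]
    rw [zero_sub]
    exact (hasSum_betaDigit_sub h.beta_gt h.mem_Icc).neg
  have hinj : Function.Injective fun q : ℕ => n * q :=
    fun q q' hqq => Nat.eq_of_mul_eq_mul_left h.n_pos hqq
  refine ((hinj.hasSum_iff (f := fun j => parryTerm b a j x) fun j hj => ?_).1 hsum).tsum_eq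
  obtain ⟨m, rfl⟩ : ∃ m, j = m + 1 := ⟨j - 1, by
    rcases Nat.eq_zero_or_pos j with h0 | h0
    · exact absurd ⟨0, by simp [h0]⟩ hj
    · omega⟩
  have hm := Nat.div_add_mod m n
  have hlt := Nat.mod_lt m h.n_pos
  rw [← hm]
  refine hlow _ _ ?_
  by_contra hc
  refine hj ⟨m / n + 1, ?_⟩
  dsimp only
  rw [Nat.mul_succ]
  omega

/-- The set of parameters of the central interval where Parry's density is positive. -/
lemma exists_countable_parryDensity_pos (h : RotationData n k b a β α)
    (hTr : √2 < β ∨ IsTransitiveOnUnit (Tplus β α) ∨ IsTransitiveOnUnit (Tminus β α)) :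
    ∃ C : Set ℝ, C.Countable ∧ ∀ y ∈ Ioo (0 : ℝ) 1, y ∉ C →
      0 < parryDensity b a ((b - 1) * y + a) := by
  have hn := h.two_le
  have hp := h.discontinuity_mem_Ioo
  have hβ := h.beta_gt
  have hβ0 : 0 < β := by linarith
  have hT := isBranchMap_Tplus (α := a) h.one_lt
  have hTβ := isBranchMap_Tplus (α := α) h.beta_gt
  have htend : Tendsto (fun z => towerMap n k b a α (n - 2) ((z - α) / β)) (𝓝[<] 1)
      (𝓝[<] ((1 - a) / b)) := by
    refine tendsto_nhdsWithin_iff.2 ⟨?_, ?_⟩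
    · rw [← h.towerMap_discontinuity]
      have hc : Continuous fun z => towerMap n k b a α (n - 2) ((z - α) / β) :=
        (continuous_towerMap _).comp (by fun_prop)
      exact (hc.tendsto 1).mono_left nhdsWithin_le_nhds
    · filter_upwards [self_mem_nhdsWithin] with z hz
      rw [← h.towerMap_discontinuity]
      exact h.towerMap_strictMono _ (div_lt_div_of_pos_right (sub_lt_sub_right hz _) hβ0)
  -- The parameter `(z - α)/β` is sent to `z` by `T_β`. In level `n - 2` it lies just left of the
  -- discontinuity of `T`, where the density is positive, and two further steps lead to `Φ(z)`.
  have hev : ∀ᶠ z in 𝓝[<] (1 : ℝ), 0 < parryDensity b a ((b - 1) * z + a) := by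
    have hα1 : α < 1 := by linarith [h.mem_Icc.2]
    filter_upwards [htend.eventually ((parryDensity_tendsto_left h.one_lt
      h.param_mem_Icc).eventually_const_lt h.b_pos), Ioo_mem_nhdsLT hα1] with z hz hzI
    have hyI : (z - α) / β ∈ Icc (0 : ℝ) 1 := by
      refine ⟨div_nonneg (by linarith [hzI.1]) hβ0.le, ?_⟩
      rw [div_le_one hβ0]
      linarith [hzI.2, h.mem_Icc.1]
    have hylt : (z - α) / β < (1 - α) / β :=
      div_lt_div_of_pos_right (sub_lt_sub_right hzI.2 _) hβ0
    have hret := h.iterate_return hT hTβ (Or.inl rfl) hyI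
    rw [hTβ.left _ hylt, show (Tplus b a)^[n] = (Tplus b a)^[2 + (n - 2)] by
      rw [Nat.add_sub_cancel' hn], Function.iterate_add_apply,
      h.iterate_lower hT (by omega) hyI,
      show β * ((z - α) / β) + α = z by field_simp; ring] at hret
    rw [← hret]
    exact parryDensity_pos_iterate h.one_lt h.param_mem_Icc hz 2
  obtain ⟨w, hw, hsub⟩ := mem_nhdsLT_iff_exists_Ioo_subset.1 hev
  -- One step of `T_β` is `n` steps of `T`, which preserve positivity.
  have hinv : ∀ y ∈ Icc (0 : ℝ) 1, y ∈ {y | 0 < parryDensity b a ((b - 1) * y + a)} →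
      Tplus β α y ∈ {y | 0 < parryDensity b a ((b - 1) * y + a)} := by
    intro y hy hpos
    rw [mem_ofPred_eq, ← h.iterate_return hT hTβ (Or.inl rfl) hy]
    exact parryDensity_pos_iterate h.one_lt h.param_mem_Icc hpos n
  obtain ⟨C, hC, hCsub⟩ := exists_countable_unit_diff_subset hβ h.mem_Icc hTr hinv
    (le_max_right w 0) (max_lt hw one_pos) le_rfl
    ((Ioo_subset_Ioo_left (le_max_left w 0)).trans hsub)
  exact ⟨C, hC, fun y hy hyC => hCsub ⟨hy, hyC⟩⟩

/-- The support of Parry's measure is the tower. -/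
lemma support_parryMeasure (h : RotationData n k b a β α)
    (hTr : √2 < β ∨ IsTransitiveOnUnit (Tplus β α) ∨ IsTransitiveOnUnit (Tminus β α)) :
    (parryMeasure b a).support = towerUnion n k b a β α := by
  have hn := h.two_le
  have hp := h.discontinuity_mem_Ioo
  have hT := isBranchMap_Tplus (α := a) h.one_lt
  rw [parryMeasure_support_eq h.one_lt h.param_mem_Icc]
  apply Subset.antisymm
  · refine Measure.support_subset_of_isClosed isClosed_towerUnion ?_
    rw [mem_ae_iff, parryMeasureAux, withDensity_apply _ isClosed_towerUnion.measurableSet.compl,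
      setLIntegral_congr_fun (g := fun _ => 0) isClosed_towerUnion.measurableSet.compl
        fun x hx => by simp [h.parryDensity_eq_zero_off_tower hx]]
    simp
  · obtain ⟨C, hC, hpos⟩ := h.exists_countable_parryDensity_pos hTr
    have hiter : ∀ y ∈ Ioo (0 : ℝ) 1, y ∉ C → ∀ i,
        0 < parryDensity b a ((Tplus b a)^[i] ((b - 1) * y + a)) := fun y hy hyC i =>
      parryDensity_pos_iterate h.one_lt h.param_mem_Icc (hpos y hy hyC) i
    rintro x (hx | hx | hx)
    · obtain ⟨i, hi, hx⟩ := mem_iUnion₂.1 hx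
      rw [Finset.mem_range] at hi
      refine image_Icc_subset_support h.one_lt (continuous_towerMap i) (h.towerMap_strictMono i)
        one_pos hC (fun y hy hyC => ?_) hx
      rw [← h.iterate_lower hT (by omega) ⟨hy.1.le, hy.2.le⟩]
      exact hiter y hy hyC i
    · refine image_Icc_subset_support h.one_lt (continuous_towerMap _) (h.towerMap_strictMono _)
        hp.2 hC (fun y hy hyC => ?_) hx
      have hyI : y ∈ Ioo (0 : ℝ) 1 := ⟨hp.1.trans hy.1, hy.2⟩
      rw [← h.iterate_pred_of_gt hT ⟨hyI.1.le, hyI.2.le⟩ hy.1]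
      exact hiter y hyI hyC _
    · refine image_Icc_subset_support h.one_lt ((continuous_towerMap _).add continuous_const)
        ((h.towerMap_strictMono _).add_const 1) hp.1 hC (fun y hy hyC => ?_) hx
      have hyI : y ∈ Ioo (0 : ℝ) 1 := ⟨hy.1, hy.2.trans hp.2⟩
      rw [Pi.add_apply, ← h.iterate_pred_of_lt hT ⟨hyI.1.le, hyI.2.le⟩ hy.2]
      exact hiter y hyI hyC _

end RotationData

/-! ### Preperiodic points of the tower. -/

lemma finite_orbit_succ_iff (T : ℝ → ℝ) (x : ℝ) :
    (range fun j : ℕ => T^[j] (T x)).Finite ↔ (range fun j : ℕ => T^[j] x).Finite := by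
  constructor
  · intro h
    refine (h.insert x).subset ?_
    rintro _ ⟨j, rfl⟩
    cases j with
    | zero => exact Or.inl rfl
    | succ j => exact Or.inr ⟨j, rfl⟩
  · intro h
    refine h.subset ?_
    rintro _ ⟨j, rfl⟩
    exact ⟨j + 1, rfl⟩

lemma finite_orbit_iterate_iff (T : ℝ → ℝ) (x : ℝ) (i : ℕ) :
    (range fun j : ℕ => T^[j] (T^[i] x)).Finite ↔ (range fun j : ℕ => T^[j] x).Finite := by
  induction i with
  | zero => rfl
  | succ i ih => rw [Function.iterate_succ_apply', finite_orbit_succ_iff, ih]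

lemma IsBranchMap.eq_or {v : ℝ} {T : ℝ → ℝ} (hT : IsBranchMap β α v T) (hβ : 1 < β)
    (hv : v = 0 ∨ v = 1) (x : ℝ) : T x = β * x + α ∨ T x = β * x + α - 1 := by
  rcases lt_trichotomy x ((1 - α) / β) with hlt | rfl | hgt
  · exact Or.inl (hT.left _ hlt)
  · rw [hT.at_discontinuity, show β * ((1 - α) / β) = 1 - α by field_simp]
    rcases hv with rfl | rfl
    · right; ring
    · left; ring
  · exact Or.inr (hT.right _ hgt)

namespace RotationData

variable {T Tβ : ℝ → ℝ} {v : ℝ}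

/-- The times divisible by `n` reproduce the `T_β`-orbit through an injective affine map; the other
times add only its images under finitely many iterates. -/
lemma finite_orbit_renorm_iff (h : RotationData n k b a β α) (hT : IsBranchMap b a v T)
    (hTβ : IsBranchMap β α v Tβ) (hv : v = 0 ∨ v = 1)
    (hTI : ∀ x ∈ Icc (0 : ℝ) 1, Tβ x ∈ Icc (0 : ℝ) 1) {x : ℝ} (hx : x ∈ Icc (0 : ℝ) 1) :
    (range fun j : ℕ => T^[j] ((b - 1) * x + a)).Finite ↔
      (range fun j : ℕ => Tβ^[j] x).Finite := by
  have hb : b - 1 ≠ 0 := by linarith [h.one_lt]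
  constructor
  · intro hfin
    refine Finite.of_finite_image (f := fun y => (b - 1) * y + a) (hfin.subset ?_)
      fun y _ y' _ hyy => mul_left_cancel₀ hb (add_right_cancel hyy)
    rintro _ ⟨_, ⟨q, rfl⟩, rfl⟩
    exact ⟨n * q, h.iterate_mul_return hT hTβ hv hTI hx q⟩
  · intro hfin
    refine ((Finset.range n).finite_toSet.biUnion fun i _ =>
      ((hfin.image fun y => (b - 1) * y + a).image T^[i])).subset ?_
    rintro _ ⟨j, rfl⟩
    refine mem_iUnion₂.2 ⟨j % n, Finset.mem_coe.2 (Finset.mem_range.2 (Nat.mod_lt _ h.n_pos)),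
      _, ⟨_, ⟨j / n, rfl⟩, rfl⟩, ?_⟩
    dsimp only
    rw [← h.iterate_mul_return hT hTβ hv hTI hx, ← Function.iterate_add_apply, Nat.mod_add_div]

lemma Icc_subset_betaDomain (h : RotationData n k b a β α) : Icc 0 1 ⊆ betaDomain b a := by
  have hb := h.one_lt
  obtain ⟨h0, h2⟩ := h.param_mem_Icc
  refine Icc_subset_Icc ?_ ?_
  · exact div_nonpos_of_nonpos_of_nonneg (by linarith) (by linarith)
  · rw [one_le_div (by linarith)]; linarith

/-- The preperiodic points in the tower, for a branch map and its renormalisation. -/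
lemma preper_inter_towerUnion (h : RotationData n k b a β α) (hPisot : IsPisot β)
    (hαQ : α ∈ fieldQ β) (hT : IsBranchMap b a v T) (hTβ : IsBranchMap β α v Tβ)
    (hv : v = 0 ∨ v = 1) (hTI : ∀ x ∈ Icc (0 : ℝ) 1, T x ∈ Icc (0 : ℝ) 1)
    (hTβI : ∀ x ∈ Icc (0 : ℝ) 1, Tβ x ∈ Icc (0 : ℝ) 1) :
    {x | x ∈ betaDomain b a ∧ (range fun j : ℕ => T^[j] x).Finite} ∩ towerUnion n k b a β α =
      (⋃ i ∈ Finset.range n, T^[i] '' ((fun x => (b - 1) * x + a) '' (fieldQ β ∩ Icc 0 1))) ∪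
        {1 - v} := by
  obtain ⟨h0, h2⟩ := h.param_mem_Icc
  have hb := h.one_lt
  have hfin : ∀ x ∈ Icc (0 : ℝ) 1, ((range fun j : ℕ => T^[j] ((b - 1) * x + a)).Finite ↔
      x ∈ fieldQ β) := by
    intro x hx
    rw [h.finite_orbit_renorm_iff hT hTβ hv hTβI hx]
    exact ⟨mem_fieldQ_of_finite_orbit h.beta_gt hαQ (hTβ.eq_or h.beta_gt hv),
      fun hxQ => finite_orbit_of_mem_fieldQ hPisot hαQ (hTβ.eq_or h.beta_gt hv) hTβI hxQ hx⟩
  rw [h.towerUnion_eq hT hv]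
  ext y
  constructor
  · rintro ⟨⟨-, hy⟩, hy' | hy'⟩
    · obtain ⟨i, hi, _, ⟨x, hx, rfl⟩, rfl⟩ := mem_iUnion₂.1 hy'
      rw [finite_orbit_iterate_iff, hfin x hx] at hy
      exact Or.inl (mem_iUnion₂.2 ⟨i, hi, _, ⟨x, ⟨hy, hx⟩, rfl⟩, rfl⟩)
    · exact Or.inr hy'
  · rintro (hy | hy)
    · obtain ⟨i, hi, _, ⟨x, ⟨hxQ, hx⟩, rfl⟩, rfl⟩ := mem_iUnion₂.1 hy
      refine ⟨⟨h.Icc_subset_betaDomain (iterate_mem_Icc hTI ?_ i), ?_⟩,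
        Or.inl (mem_iUnion₂.2 ⟨i, hi, _, ⟨x, hx, rfl⟩, rfl⟩)⟩
      · constructor <;> dsimp only <;> nlinarith [hx.1, hx.2]
      · rw [finite_orbit_iterate_iff, hfin x hx]; exact hxQ
    · rw [mem_singleton_iff] at hy
      have hw : y = 0 ∨ y = 1 := by rcases hv with rfl | rfl <;> simp [hy]
      refine ⟨⟨h.Icc_subset_betaDomain ?_, ?_⟩, Or.inr hy⟩
      · rcases hw with rfl | rfl <;> simp
      -- The extra point is `0` or `1`, whose image is `Φ` of itself, and both numbers lie in
      -- `ℚ(β)`.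
      · have hTy : T y = (b - 1) * y + a := by
          rcases hw with rfl | rfl
          · rw [h.branch_zero hT]; ring
          · exact h.branch_one hT
        rw [← finite_orbit_succ_iff, hTy, hfin y (by rcases hw with rfl | rfl <;> simp)]
        rcases hw with rfl | rfl
        · exact zero_mem (IntermediateField.adjoin ℚ ({β} : Set ℝ))
        · exact one_mem (IntermediateField.adjoin ℚ ({β} : Set ℝ))

end RotationData

end

end

theorem corollary1p5 (n k : ℕ) (hk : 1 ≤ k) (hkn : k < n) (hcop : Nat.gcd n k = 1)
    (β α : ℝ) (hβ : IsPisot β) (hαQ : α ∈ fieldQ β) (hα : α ∈ Set.Icc 0 (2 - β))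
    (hT : √2 < β ∨ IsTransitiveOnUnit (Tplus β α) ∨ IsTransitiveOnUnit (Tminus β α)) :
    renormParam n k β α ∈ parameterInterval n k (nthRoot n β) ∧
    PreperPlus (nthRoot n β) (renormParam n k β α) ∩
        (parryMeasure (nthRoot n β) (renormParam n k β α)).support =
      (⋃ i ∈ Finset.range n, (Tplus (nthRoot n β) (renormParam n k β α))^[i] ''
        (renormPhi n k β α '' (fieldQ β ∩ Set.Icc 0 1))) ∪ {1} ∧
    PreperMinus (nthRoot n β) (renormParam n k β α) ∩
        (parryMeasure (nthRoot n β) (renormParam n k β α)).support =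
      (⋃ i ∈ Finset.range n, (Tminus (nthRoot n β) (renormParam n k β α))^[i] ''
        (renormPhi n k β α '' (fieldQ β ∩ Set.Icc 0 1))) ∪ {0} := by
  have hβ1 := hβ.1
  have h := rotationData_renormParam hk hkn hcop hβ1 hα
  refine ⟨renormParam_mem_parameterInterval hk hkn hcop hβ1 hα, ?_, ?_⟩
  · rw [h.support_parryMeasure hT]
    have := h.preper_inter_towerUnion hβ hαQ (isBranchMap_Tplus h.one_lt) (isBranchMap_Tplus hβ1)
      (Or.inl rfl) (fun _ => Tplus_mem_Icc h.one_lt h.param_mem_Icc)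
      (fun _ => Tplus_mem_Icc hβ1 hα)
    rwa [sub_zero] at this
  · rw [h.support_parryMeasure hT]
    have := h.preper_inter_towerUnion hβ hαQ (isBranchMap_Tminus h.one_lt)
      (isBranchMap_Tminus hβ1) (Or.inr rfl) (fun _ => Tminus_mem_Icc h.one_lt h.param_mem_Icc)
      (fun _ => Tminus_mem_Icc hβ1 hα)
    rwa [sub_self] at this
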